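/- Let $A$ be a (not necessarily unital) $C^*$-algebra with multiplier algebra $M(A)$, let $S$ be an abelian semigroup with identity $0$ (written additively), and let $\alpha:S\to\operatorname{End}(A)$ be an action by endomorphisms ($\alpha_0=\mathrm{id}$, $\alpha_{s+t}=\alpha_s\circ\alpha_t$). Suppose that each $\alpha_s$ is * extendible: it extends (then uniquely) to an endomorphism $\overline{\alpha_s}$ of $M(A)$ such that $\overline{\alpha_s}(1)=\lim_\lambda\alpha_s(u_\lambda)$ strictly for some (and hence every) approximate unit $(u_\lambda)$ of $A$; * injective; and * of hereditary range: $0\le a\le\alpha_s(b)$ implies $a\in\alpha_s(A)$. For $s\in S$ and $a\in A$ put $$L_s(a):=\alpha_s^{-1}\bigl(\overline{\alpha_s}(1)\,a\,\overline{\alpha_s}(1)\bigr).$$ **(1)** This is well defined, i.e. $\overline{\alpha_s}(1)\,a\,\overline{\alpha_s}(1)\in\alpha_s(A)$, and $L$ is an action of $S$ by transfer operators for $\alpha$: $L_0=\mathrm{id}$, $L_{s+t}=L_s\circ L_t$, and each $L_s$ is a continuous positive linear map that has a continuous linear extension $\overline{L_s}:M(A)\to M(A)$ with $L_s(\alpha_s(a)u)=a\,\overline{L_s}(u)$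 for all $a\in A$, $u\in M(A)$. **(2)** $A\rtimes_{\alpha,L}S\cong A\rtimes_\alpha S$ canonically. Here the two algebras are the following. Consider pairs $(\pi,V)$ of a non-degenerate representation $\pi:A\to B(H)$ on a Hilbert space and a map $V:S\to B(H)$ with $V_0=1$, $V_{s+t}=V_sV_t$. Such a pair is *Toeplitz covariant* if $V_s\pi(a)=\pi(\alpha_s(a))V_s$ and $V_s^*\pi(a)V_s=\pi(L_s(a))$ for all $a\in A$, $s\in S$; it is *covariant* if every $V_s$ is an isometry and $V_s\pi(a)V_s^*=\pi(\alpha_s(a))$ for all $a\in A$, $s\in S$. A universal $C^*$-algebra for one of these two classes of pairs is a triple $(B,i_A,i_S)$ of a $C^*$-algebra $B$, a non-degenerate homomorphism $i_A:A\to B$ and a map $i_S:S\to M(B)$ with $i_S(0)=1$, $i_S(s+t)=i_S(s)i_S(t)$, such that (i) for every non-degenerate representation $\sigma$ of $B$ the pair $(\sigma\circ i_A,\overline\sigma\circ i_S)$ belongs to the class, where $\overline\sigma$ is the extension of $\sigma$ to $M(B)$; (ii) for every pair $(\pi,V)$ of the class there is a representation $\sigma$ of $B$ with $\sigma\circ i_A=\pi$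 and $\overline\sigma\circ i_S=V$; (iii) $B$ is generated as a $C^*$-algebra by $\{i_A(a)i_S(s): a\in A,\ s\in S\}$. Such a triple exists for each of the two classes. The one for Toeplitz covariant pairs is the Toeplitz crossed product $(\mathcal T,i_A,i_S)$ of $(A,S,\alpha,L)$; the one for covariant pairs is the semigroup crossed product $(A\rtimes_\alpha S,j_A,j_S)$. A *redundancy* is a pair $(a,k)\in\mathcal T\times\mathcal T$ such that for some $s\in S$ we have $a\in i_A(A)$, $k\in\overline{\operatorname{span}}\,i_A(A)i_S(s)i_S(s)^*i_A(A)$, and $a\,i_A(b)i_S(s)=k\,i_A(b)i_S(s)$ for all $b\in A$. Let $I$ be the closed two-sided ideal of $\mathcal T$ generated by the differences $a-k$ of those redundancies for which moreover (with the same $s$) $a\in\overline{\operatorname{span}}\,i_A(A\alpha_s(A)A)$, and let $A\rtimes_{\alpha,L}S:=\mathcal T/I$. The claim is that there is a $*$-isomorphism $\Phi:A\rtimes_{\alpha,L}S\to A\rtimes_\alpha S$ with $\Phi(i_A(a)+I)=j_A(a)$ and $\Phi(i_A(a)i_S(s)+I)=j_A(a)j_S(s)$ for all $a\in A$, $s\in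 S$, whichever universal triples are chosen. -/

import Mathlib

open Filter Topology
open scoped MultiplierAlgebra

/-! ### Closed ideals and quotient C⋆-algebras -/

/-- A closed two-sided ideal of a C⋆-algebra. -/
structure ClosedIdeal (B : Type*) [NonUnitalCStarAlgebra B] extends Submodule ℂ B where
  isClosed' : IsClosed carrier
  mul_mem_left' : ∀ (b : B) {x : B}, x ∈ carrier → b * x ∈ carrier
  mul_mem_right' : ∀ {x : B} (b : B), x ∈ carrier → x * b ∈ carrier

namespace ClosedIdeal

variable {B : Type*} [NonUnitalCStarAlgebra B]

/-- The closed two-sided ideal generated by a set. -/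
def span (E : Set B) : ClosedIdeal B where
  toSubmodule := sInf {J : Submodule ℂ B | ∃ I : ClosedIdeal B, I.toSubmodule = J ∧ E ⊆ J}
  isClosed' := by
    change IsClosed ((sInf {J : Submodule ℂ B | ∃ I : ClosedIdeal B, I.toSubmodule = J ∧ E ⊆ J} :
      Submodule ℂ B) : Set B)
    rw [Submodule.coe_sInf]
    refine isClosed_biInter ?_
    rintro J ⟨I, rfl, -⟩
    exact I.isClosed'
  mul_mem_left' := by
    intro b x hx
    refine (Submodule.mem_sInf).2 ?_
    rintro J ⟨I, rfl, hE⟩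
    exact I.mul_mem_left' b ((Submodule.mem_sInf).1 hx _ ⟨I, rfl, hE⟩)
  mul_mem_right' := by
    intro x b hx
    refine (Submodule.mem_sInf).2 ?_
    rintro J ⟨I, rfl, hE⟩
    exact I.mul_mem_right' b ((Submodule.mem_sInf).1 hx _ ⟨I, rfl, hE⟩)

variable (I : ClosedIdeal B)

instance : IsClosed (I.toSubmodule : Set B) := I.isClosed'

theorem mul_left {x : B} (b : B) (hx : x ∈ I.toSubmodule) : b * x ∈ I.toSubmodule :=
  I.mul_mem_left' b hx

theorem mul_right {x : B} (b : B) (hx : x ∈ I.toSubmodule) : x * b ∈ I.toSubmodule :=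
  I.mul_mem_right' b hx

/-- The elements `x` with `x` and `star x` in the ideal (in the end, all of the ideal). -/
def starPart : NonUnitalStarSubalgebra ℂ B where
  carrier := {x | x ∈ I.toSubmodule ∧ star x ∈ I.toSubmodule}
  add_mem' := fun ha hb => ⟨add_mem ha.1 hb.1, by rw [star_add]; exact add_mem ha.2 hb.2⟩
  zero_mem' := ⟨zero_mem _, by rw [star_zero]; exact zero_mem _⟩
  mul_mem' := fun {a b} ha hb =>
    ⟨I.mul_left a hb.1, by rw [star_mul]; exact I.mul_left (star b) ha.2⟩
  smul_mem' := fun c x hx => ⟨Submodule.smul_mem _ c hx.1, by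
    rw [star_smul]; exact Submodule.smul_mem _ _ hx.2⟩
  star_mem' := fun hx => ⟨hx.2, by rw [star_star]; exact hx.1⟩

instance : IsClosed (I.starPart : Set B) :=
  IsClosed.inter I.isClosed' (I.isClosed'.preimage continuous_star)

open CStarAlgebra in
theorem exists_approx {y : B} (hy : y ∈ I.toSubmodule) (hy' : star y ∈ I.toSubmodule)
    {ε : ℝ} (hε : 0 < ε) :
    ∃ e ∈ I.toSubmodule, star e = e ∧ ‖(1 - (e : Unitization ℂ B))‖ ≤ 1 ∧ ‖y - y * e‖ < ε := by
  let _ : PartialOrder I.starPart := spectralOrder _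
  have _ : StarOrderedRing I.starPart := spectralOrderedRing _
  let _ : PartialOrder (Unitization ℂ B) := spectralOrder _
  have _ : StarOrderedRing (Unitization ℂ B) := spectralOrderedRing _
  have h := increasingApproximateUnit I.starPart
  have h1 := (Metric.tendsto_nhds.1 (h.tendsto_mul_left ⟨y, hy, hy'⟩)) ε hε
  have hne := h.neBot
  obtain ⟨e, h1, h2, h3⟩ := (h1.and (h.eventually_nonneg.and h.eventually_norm)).exists
  obtain ⟨c, hc⟩ := (CStarAlgebra.nonneg_iff_eq_star_mul_self).1 h2
  have hn : (0 : Unitization ℂ B) ≤ ((e : B) : Unitization ℂ B) := by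
    rw [hc]
    have : (((star c * c : I.starPart) : B) : Unitization ℂ B)
      = star ((c : B) : Unitization ℂ B) * ((c : B) : Unitization ℂ B) := by
      simp [Unitization.inr_mul, Unitization.inr_star]
    rw [this]
    exact star_mul_self_nonneg _
  have hle : ((e : B) : Unitization ℂ B) ≤ 1 := by
    rw [← CStarAlgebra.norm_le_one_iff_of_nonneg _ hn, Unitization.norm_inr]
    exact h3
  refine ⟨e, e.2.1, ?_, ?_, ?_⟩
  · rw [hc]; simp
  · rw [CStarAlgebra.norm_le_one_iff_of_nonneg _ (sub_nonneg.2 hle)]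
    exact sub_le_self _ hn
  · rw [dist_comm, dist_eq_norm] at h1
    exact h1

/-- Closed two-sided ideals of C⋆-algebras are self-adjoint. -/
theorem star_mem {x : B} (hx : x ∈ I.toSubmodule) : star x ∈ I.toSubmodule := by
  have hcl : IsClosed (I.toSubmodule : Set B) := I.isClosed'
  rw [← SetLike.mem_coe, ← hcl.closure_eq, Metric.mem_closure_iff]
  intro ε hε
  have hs : x * star x ∈ I.toSubmodule := I.mul_right _ hx
  obtain ⟨e, he, hes, hn, hlt⟩ := I.exists_approx hs (by simpa using hs) (pow_pos hε 2)
  refine ⟨star x * e, I.mul_left _ he, ?_⟩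
  rw [dist_eq_norm]
  have key : ‖star x - star x * e‖ ^ 2 ≤ ‖x * star x - x * star x * e‖ := by
    rw [sq, ← CStarRing.norm_star_mul_self, ← Unitization.norm_inr (𝕜 := ℂ),
      ← Unitization.norm_inr (𝕜 := ℂ) (a := x * star x - x * star x * e)]
    have : ((star (star x - star x * e) * (star x - star x * e) : B) : Unitization ℂ B)
        = (1 - (e : Unitization ℂ B)) *
          ((x * star x - x * star x * e : B) : Unitization ℂ B) := by
      rw [sub_mul, one_mul, ← Unitization.inr_mul, ← Unitization.inr_sub]
      congr 1
      simp only [star_sub, star_star, star_mul, hes]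
      noncomm_ring
    rw [this]
    exact (norm_mul_le _ _).trans (mul_le_of_le_one_left (norm_nonneg _) hn)
  exact lt_of_pow_lt_pow_left₀ 2 hε.le (key.trans_lt hlt)

/-- The quotient C⋆-algebra `B / I`. -/
def Quotient : Type _ := B ⧸ I.toSubmodule

namespace Quotient

noncomputable instance : NormedAddCommGroup I.Quotient :=
  inferInstanceAs (NormedAddCommGroup (B ⧸ I.toSubmodule))

noncomputable instance : NormedSpace ℂ I.Quotient :=
  inferInstanceAs (NormedSpace ℂ (B ⧸ I.toSubmodule))

instance : CompleteSpace I.Quotient :=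
  inferInstanceAs (CompleteSpace (B ⧸ I.toSubmodule))

/-- The quotient map, as a linear map. -/
def mkₗ : B →ₗ[ℂ] I.Quotient := I.toSubmodule.mkQ

theorem mkₗ_surjective : Function.Surjective (mkₗ I) := I.toSubmodule.mkQ_surjective

theorem mkₗ_eq_iff {x y : B} : mkₗ I x = mkₗ I y ↔ x - y ∈ I.toSubmodule :=
  Submodule.Quotient.eq I.toSubmodule

theorem norm_mkₗ_le (x : B) : ‖mkₗ I x‖ ≤ ‖x‖ := Submodule.Quotient.norm_mk_le I.toSubmodule x

theorem exists_norm_lt (x : I.Quotient) {ε : ℝ} (hε : 0 < ε) :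
    ∃ b : B, mkₗ I b = x ∧ ‖b‖ < ‖x‖ + ε :=
  Submodule.Quotient.norm_mk_lt (S := I.toSubmodule) x hε

instance : Mul I.Quotient where
  mul := Quotient.map₂ (· * ·) (by
    intro a a' ha b b' hb
    have ha' : a - a' ∈ I.toSubmodule := (Submodule.quotientRel_def _).1 ha
    have hb' : b - b' ∈ I.toSubmodule := (Submodule.quotientRel_def _).1 hb
    refine (Submodule.quotientRel_def _).2 ?_
    have : a * b - a' * b' = (a - a') * b + a' * (b - b') := by noncomm_ring
    rw [this]
    exact add_mem (I.mul_right _ ha') (I.mul_left _ hb'))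

theorem mkₗ_mul (a b : B) : mkₗ I (a * b) = mkₗ I a * mkₗ I b := rfl

instance : Star I.Quotient where
  star := Quotient.map star (by
    intro a a' ha
    have ha' : a - a' ∈ I.toSubmodule := (Submodule.quotientRel_def _).1 ha
    refine (Submodule.quotientRel_def _).2 ?_
    rw [← star_sub]
    exact I.star_mem ha')

theorem mkₗ_star (a : B) : mkₗ I (star a) = star (mkₗ I a) := rfl

theorem ind {p : I.Quotient → Prop} (h : ∀ b, p (mkₗ I b)) (x : I.Quotient) : p x := by
  obtain ⟨b, rfl⟩ := mkₗ_surjective I x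
  exact h b

theorem norm_mul_le' (x y : I.Quotient) : ‖x * y‖ ≤ ‖x‖ * ‖y‖ := by
  have h : Filter.Tendsto (fun ε : ℝ => (‖x‖ + ε) * (‖y‖ + ε)) (nhdsWithin 0 (Set.Ioi 0))
      (nhds (‖x‖ * ‖y‖)) := by
    have : Continuous (fun ε : ℝ => (‖x‖ + ε) * (‖y‖ + ε)) := by fun_prop
    simpa using (this.tendsto 0).mono_left nhdsWithin_le_nhds
  refine ge_of_tendsto h ?_
  filter_upwards [self_mem_nhdsWithin] with ε hε
  obtain ⟨a, rfl, ha⟩ := exists_norm_lt I x hε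
  obtain ⟨b, rfl, hb⟩ := exists_norm_lt I y hε
  rw [← mkₗ_mul]
  calc _ ≤ ‖a * b‖ := norm_mkₗ_le I _
    _ ≤ ‖a‖ * ‖b‖ := norm_mul_le _ _
    _ ≤ _ := mul_le_mul ha.le hb.le (norm_nonneg _) ((norm_nonneg _).trans ha.le)

theorem norm_mul_self_le' (x : I.Quotient) : ‖x‖ * ‖x‖ ≤ ‖star x * x‖ := by
  obtain ⟨b, rfl⟩ := mkₗ_surjective I x
  refine le_of_forall_pos_le_add fun ε hε => ?_
  obtain ⟨c, hc, hlt⟩ := exists_norm_lt I (star (mkₗ I b) * mkₗ I b) (half_pos hε)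
  rw [← mkₗ_star, ← mkₗ_mul, mkₗ_eq_iff] at hc
  obtain ⟨e, he, hes, hn, hy⟩ := I.exists_approx hc (I.star_mem hc) (half_pos hε)
  have h1 : ‖mkₗ I b‖ ≤ ‖b - b * e‖ := by
    have : mkₗ I b = mkₗ I (b - b * e) := by
      rw [mkₗ_eq_iff]; simpa using I.mul_left b he
    rw [this]; exact norm_mkₗ_le I _
  have h2 : ‖b - b * e‖ * ‖b - b * e‖ ≤ ‖c‖ + ‖(c - star b * b) - (c - star b * b) * e‖ := by
    rw [← CStarRing.norm_star_mul_self, ← Unitization.norm_inr (𝕜 := ℂ),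
      ← Unitization.norm_inr (𝕜 := ℂ) (a := c), ← Unitization.norm_inr (𝕜 := ℂ)
        (a := (c - star b * b) - (c - star b * b) * e)]
    set u : Unitization ℂ B := 1 - (e : Unitization ℂ B) with hu
    have : ((star (b - b * e) * (b - b * e) : B) : Unitization ℂ B)
        = u * (c : Unitization ℂ B) * u -
          u * (((c - star b * b) - (c - star b * b) * e : B) : Unitization ℂ B) := by
      simp only [star_sub, star_mul, hes, Unitization.inr_sub, Unitization.inr_mul, hu]
      noncomm_ring
    rw [this]
    refine (norm_sub_le _ _).trans (add_le_add ?_ ?_)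
    · calc _ ≤ ‖u‖ * ‖(c : Unitization ℂ B)‖ * ‖u‖ :=
            (norm_mul_le _ _).trans (mul_le_mul_of_nonneg_right (norm_mul_le _ _) (norm_nonneg _))
        _ ≤ 1 * ‖(c : Unitization ℂ B)‖ * 1 := by gcongr
        _ = _ := by ring
    · exact (norm_mul_le _ _).trans (mul_le_of_le_one_left (norm_nonneg _) hn)
  have h3 := mul_le_mul h1 h1 (norm_nonneg _) (norm_nonneg _)
  linarith

noncomputable instance : NonUnitalCStarAlgebra I.Quotient where
  left_distrib x y z := by
    induction x using ind; induction y using ind; induction z using ind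
    simp only [← map_add, ← mkₗ_mul, mul_add]
  right_distrib x y z := by
    induction x using ind; induction y using ind; induction z using ind
    simp only [← map_add, ← mkₗ_mul, add_mul]
  zero_mul x := by
    induction x using ind
    rw [← map_zero (mkₗ I), ← mkₗ_mul, zero_mul]
  mul_zero x := by
    induction x using ind
    rw [← map_zero (mkₗ I), ← mkₗ_mul, mul_zero]
  mul_assoc x y z := by
    induction x using ind; induction y using ind; induction z using ind
    simp only [← mkₗ_mul, mul_assoc]
  dist_eq := NormedAddCommGroup.dist_eq
  norm_mul_le := norm_mul_le' I
  star_involutive x := by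
    induction x using ind
    simp only [← mkₗ_star, star_star]
  star_mul x y := by
    induction x using ind; induction y using ind
    simp only [← mkₗ_star, ← mkₗ_mul, star_mul]
  star_add x y := by
    induction x using ind; induction y using ind
    simp only [← mkₗ_star, ← map_add, star_add]
  norm_mul_self_le := norm_mul_self_le' I
  smul_zero := smul_zero
  smul_add := smul_add
  add_smul := add_smul
  zero_smul := zero_smul ℂ
  norm_smul_le := norm_smul_le
  smul_assoc c x y := by
    induction x using ind; induction y using ind
    simp only [smul_eq_mul, ← map_smul, ← mkₗ_mul, smul_mul_assoc]
  smul_comm c x y := by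
    induction x using ind; induction y using ind
    simp only [smul_eq_mul, ← map_smul, ← mkₗ_mul, mul_smul_comm]
  star_smul c x := by
    induction x using ind
    simp only [← map_smul, ← mkₗ_star, star_smul]

/-- The quotient map `B → B / I`. -/
noncomputable def mk : B →⋆ₙₐ[ℂ] I.Quotient where
  toFun := mkₗ I
  map_smul' := map_smul (mkₗ I)
  map_zero' := map_zero (mkₗ I)
  map_add' := map_add (mkₗ I)
  map_mul' := mkₗ_mul I
  map_star' := mkₗ_star I

end Quotient

end ClosedIdeal

/-! ### Multipliers -/

section Multipliers

variable {A : Type*} [NonUnitalCStarAlgebra A]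

/-- The element `m a` of `A`, for `m ∈ M(A)` and `a ∈ A`. -/
noncomputable def multLeft (m : 𝓜(ℂ, A)) (a : A) : A := m.fst a

/-- The element `a m` of `A`, for `a ∈ A` and `m ∈ M(A)`. -/
noncomputable def multRight (a : A) (m : 𝓜(ℂ, A)) : A := m.snd a

theorem coe_multLeft (m : 𝓜(ℂ, A)) (a : A) :
    ((multLeft m a : A) : 𝓜(ℂ, A)) = m * (a : 𝓜(ℂ, A)) := by
  have hfst : ∀ y : A, multLeft m a * y = m.fst (a * y) := by
    intro y
    refine sub_eq_zero.1 (CStarRing.star_mul_self_eq_zero_iff _ |>.1 ?_)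
    set z := multLeft m a * y - m.fst (a * y) with hz
    have h : ∀ w : A, w * z = 0 := by
      intro w
      rw [hz, mul_sub, ← mul_assoc, multLeft, ← m.central, ← m.central, mul_assoc, sub_self]
    exact h _
  apply DoubleCentralizer.ext
  refine Prod.ext (ContinuousLinearMap.ext fun y => ?_) (ContinuousLinearMap.ext fun y => ?_)
  · exact hfst y
  · exact (m.central y a).symm

theorem coe_multRight (a : A) (m : 𝓜(ℂ, A)) :
    ((multRight a m : A) : 𝓜(ℂ, A)) = (a : 𝓜(ℂ, A)) * m := by
  have hsnd : ∀ y : A, y * multRight a m = m.snd (y * a) := by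
    intro y
    refine sub_eq_zero.1 (CStarRing.mul_star_self_eq_zero_iff _ |>.1 ?_)
    set z := y * multRight a m - m.snd (y * a) with hz
    have h : ∀ w : A, z * w = 0 := by
      intro w
      rw [hz, sub_mul, mul_assoc, multRight, m.central, m.central, ← mul_assoc, sub_self]
    exact h _
  apply DoubleCentralizer.ext
  refine Prod.ext (ContinuousLinearMap.ext fun y => ?_) (ContinuousLinearMap.ext fun y => ?_)
  · exact m.central a y
  · exact hsnd y

theorem multiplier_ext {m n : 𝓜(ℂ, A)} (h : ∀ x, multLeft m x = multLeft n x) : m = n := by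
  apply DoubleCentralizer.ext
  refine Prod.ext (ContinuousLinearMap.ext fun y => h y) (ContinuousLinearMap.ext fun y => ?_)
  refine sub_eq_zero.1 (CStarRing.mul_star_self_eq_zero_iff _ |>.1 ?_)
  have hz : ∀ w : A, (m.snd y - n.snd y) * w = 0 := by
    intro w
    rw [sub_mul, m.central, n.central, sub_eq_zero]
    exact congrArg (y * ·) (h w)
  exact hz _

theorem multiplierCoe_injective : Function.Injective (fun a : A => (a : 𝓜(ℂ, A))) := by
  intro a b hab
  refine sub_eq_zero.1 (CStarRing.mul_star_self_eq_zero_iff _ |>.1 ?_)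
  have h : ∀ w : A, (a - b) * w = 0 := by
    intro w
    rw [sub_mul, sub_eq_zero]
    exact congrArg (fun m : 𝓜(ℂ, A) => m.fst w) hab
  exact h _

end Multipliers

/-! ### Extendible endomorphisms and transfer operators -/

section Endomorphisms

variable {A : Type*} [NonUnitalCStarAlgebra A] [PartialOrder A]

/-- `β` is an endomorphism of `M(A)` that extends `α` and satisfies `β(1) = lim α(u)` strictly,
where `u` runs over some approximate unit of `A`. -/
def IsStrictExtension (α : A →⋆ₙₐ[ℂ] A) (β : 𝓜(ℂ, A) →⋆ₙₐ[ℂ] 𝓜(ℂ, A)) : Prop :=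
  (∀ a : A, β (a : 𝓜(ℂ, A)) = (α a : 𝓜(ℂ, A))) ∧
    ∃ l : Filter A, l.IsIncreasingApproximateUnit ∧
      ∀ x : A, Tendsto (fun u => α u * x) l (𝓝 (multLeft (β 1) x)) ∧
        Tendsto (fun u => x * α u) l (𝓝 (multRight x (β 1)))

/-- The endomorphism `α` of `A` is extendible. -/
def IsExtendible (α : A →⋆ₙₐ[ℂ] A) : Prop :=
  ∃ β : 𝓜(ℂ, A) →⋆ₙₐ[ℂ] 𝓜(ℂ, A), IsStrictExtension α β

theorem IsStrictExtension.one_mul_one {α : A →⋆ₙₐ[ℂ] A} {β γ : 𝓜(ℂ, A) →⋆ₙₐ[ℂ] 𝓜(ℂ, A)}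
    (hβ : IsStrictExtension α β) (hγ : IsStrictExtension α γ) : β 1 * γ 1 = γ 1 := by
  obtain ⟨l, hl, hlim⟩ := hγ.2
  have := hl.neBot
  refine multiplier_ext fun x => ?_
  have h1 := (((β 1).fst.continuous.tendsto _).comp (hlim x).1)
  refine tendsto_nhds_unique h1 ((hlim x).1.congr fun u => ?_)
  refine multiplierCoe_injective ?_
  change ((α u * x : A) : 𝓜(ℂ, A)) = ((multLeft (β 1) (α u * x) : A) : 𝓜(ℂ, A))
  have hm : ((α u * x : A) : 𝓜(ℂ, A)) = (α u : 𝓜(ℂ, A)) * (x : 𝓜(ℂ, A)) :=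
    map_mul (DoubleCentralizer.coeHom (𝕜 := ℂ) (A := A)) _ _
  rw [coe_multLeft, hm, ← hβ.1, ← mul_assoc, ← map_mul, one_mul]

theorem IsStrictExtension.unique {α : A →⋆ₙₐ[ℂ] A} {β γ : 𝓜(ℂ, A) →⋆ₙₐ[ℂ] 𝓜(ℂ, A)}
    (hβ : IsStrictExtension α β) (hγ : IsStrictExtension α γ) : β = γ := by
  have h1 : β 1 = γ 1 := by
    have h := congrArg star (hβ.one_mul_one hγ)
    rw [star_mul, ← map_star, ← map_star, star_one, hγ.one_mul_one hβ] at h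
    exact h
  ext1 m
  obtain ⟨l, hl, hlim⟩ := hβ.2
  have := hl.neBot
  have key : β m * β 1 = γ m * β 1 := by
    refine multiplier_ext fun x => ?_
    have e1 := (((β m).fst.continuous.tendsto _).comp (hlim x).1)
    have e2 := (((γ m).fst.continuous.tendsto _).comp (hlim x).1)
    refine tendsto_nhds_unique e1 (e2.congr fun u => ?_)
    refine multiplierCoe_injective ?_
    change ((multLeft (γ m) (α u * x) : A) : 𝓜(ℂ, A)) =
      ((multLeft (β m) (α u * x) : A) : 𝓜(ℂ, A))
    have hm : ((α u * x : A) : 𝓜(ℂ, A)) = (α u : 𝓜(ℂ, A)) * (x : 𝓜(ℂ, A)) :=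
      map_mul (DoubleCentralizer.coeHom (𝕜 := ℂ) (A := A)) _ _
    have h2 : β m * (α u : 𝓜(ℂ, A)) = γ m * (α u : 𝓜(ℂ, A)) := by
      rw [← hβ.1, ← map_mul, ← coe_multLeft, hβ.1, ← hγ.1, coe_multLeft, map_mul, hγ.1, hβ.1]
    rw [coe_multLeft, coe_multLeft, hm, ← mul_assoc, ← mul_assoc, h2]
  rw [h1, ← map_mul, mul_one] at key
  rw [← key, ← h1, ← map_mul, mul_one]

/-- The extension `ᾱ : M(A) → M(A)` of an extendible endomorphism. -/
noncomputable def IsExtendible.extension {α : A →⋆ₙₐ[ℂ] A} (h : IsExtendible α) :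
    𝓜(ℂ, A) →⋆ₙₐ[ℂ] 𝓜(ℂ, A) :=
  h.choose

/-- The range of `α` is a hereditary subalgebra of `A` (it is always a C⋆-subalgebra). -/
def HasHereditaryRange (α : A →⋆ₙₐ[ℂ] A) : Prop :=
  ∀ a b : A, 0 ≤ a → a ≤ α b → a ∈ Set.range α

/-- An action of the additive monoid `S` by endomorphisms of `A`. -/
structure IsEndomorphismAction {A S : Type*} [NonUnitalCStarAlgebra A] [AddCommMonoid S]
    (α : S → A →⋆ₙₐ[ℂ] A) : Prop where
  map_zero : ∀ a, α 0 a = a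
  map_add : ∀ s t a, α (s + t) a = α s (α t a)

/-- `L` is an action of `S` by transfer operators for the action `α`. -/
structure IsTransferAction {S : Type*} [AddCommMonoid S] (α : S → A →⋆ₙₐ[ℂ] A)
    (L : S → A → A) : Prop where
  map_zero : ∀ a, L 0 a = a
  map_add : ∀ s t a, L (s + t) a = L s (L t a)
  isLinear : ∀ s, IsLinearMap ℂ (L s)
  continuous : ∀ s, Continuous (L s)
  nonneg : ∀ s a, 0 ≤ a → 0 ≤ L s a
  /-- the extension of `L s` to `M(A)` and the transfer operator identity -/
  exists_extension : ∀ s, ∃ Lbar : 𝓜(ℂ, A) →L[ℂ] 𝓜(ℂ, A),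
    (∀ a : A, Lbar (a : 𝓜(ℂ, A)) = (L s a : 𝓜(ℂ, A))) ∧
    ∀ (a : A) (u : 𝓜(ℂ, A)), L s (multRight (α s a) u) = multRight a (Lbar u)

/-- `L_s(a) = α_s⁻¹(ᾱ_s(1) a ᾱ_s(1))`. -/
noncomputable def hereditaryTransfer {S : Type*} (α : S → A →⋆ₙₐ[ℂ] A)
    (hα : ∀ s, IsExtendible (α s)) (s : S) (a : A) : A :=
  Function.invFun (α s)
    (multRight (multLeft ((hα s).extension 1) a) ((hα s).extension 1))

end Endomorphisms

/-! ### Covariant representations and universal algebras -/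

section Representations

/-- A representation of the additive monoid `S` in a (multiplicative) monoid. -/
structure IsSemigroupRep {S M : Type*} [AddCommMonoid S] [Monoid M] (V : S → M) : Prop where
  map_zero : V 0 = 1
  map_add : ∀ s t, V (s + t) = V s * V t

/-- Non-degeneracy of a representation on a Hilbert space: `π(A)H` spans a dense subspace. -/
def IsNondegenerateRep {A H : Type*} [NonUnitalCStarAlgebra A] [NormedAddCommGroup H]
    [InnerProductSpace ℂ H] [CompleteSpace H] (π : A →⋆ₙₐ[ℂ] (H →L[ℂ] H)) : Prop :=
  Dense (Submodule.span ℂ {x : H | ∃ (a : A) (h : H), π a h = x} : Set H)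

/-- Non-degeneracy of a homomorphism of C⋆-algebras: `i(A)B` spans a dense subspace. -/
def IsNondegenerateHom {A B : Type*} [NonUnitalCStarAlgebra A] [NonUnitalCStarAlgebra B]
    (i : A →⋆ₙₐ[ℂ] B) : Prop :=
  Dense (Submodule.span ℂ {x : B | ∃ (a : A) (b : B), i a * b = x} : Set B)

/-- `σbar` is a unital extension of the representation `σ` to the multiplier algebra (for
non-degenerate `σ` there is exactly one, the canonical extension). -/
def IsMultiplierExtension {B H : Type*} [NonUnitalCStarAlgebra B] [NormedAddCommGroup H]
    [InnerProductSpace ℂ H] [CompleteSpace H] (σ : B →⋆ₙₐ[ℂ] (H →L[ℂ] H))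
    (σbar : 𝓜(ℂ, B) →⋆ₐ[ℂ] (H →L[ℂ] H)) : Prop :=
  ∀ b : B, σbar (b : 𝓜(ℂ, B)) = σ b

variable {A S : Type*} [NonUnitalCStarAlgebra A] [AddCommMonoid S]

/-- Toeplitz covariant representations of `(A, S, α, L)` on a Hilbert space. -/
structure IsToeplitzCovariant (α : S → A →⋆ₙₐ[ℂ] A) (L : S → A → A) (H : Type*)
    [NormedAddCommGroup H] [InnerProductSpace ℂ H] [CompleteSpace H]
    (π : A →⋆ₙₐ[ℂ] (H →L[ℂ] H)) (V : S → (H →L[ℂ] H)) : Prop where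
  nondegenerate : IsNondegenerateRep π
  isRep : IsSemigroupRep V
  tc1 : ∀ s a, V s * π a = π (α s a) * V s
  tc2 : ∀ s a, star (V s) * π a * V s = π (L s a)

/-- Covariant representations of `(A, S, α)` on a Hilbert space, with `S` acting by isometries. -/
structure IsIsometricCovariant (α : S → A →⋆ₙₐ[ℂ] A) (H : Type*)
    [NormedAddCommGroup H] [InnerProductSpace ℂ H] [CompleteSpace H]
    (π : A →⋆ₙₐ[ℂ] (H →L[ℂ] H)) (V : S → (H →L[ℂ] H)) : Prop where
  nondegenerate : IsNondegenerateRep π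
  isRep : IsSemigroupRep V
  isometry : ∀ s, star (V s) * V s = 1
  covariance : ∀ s a, V s * π a * star (V s) = π (α s a)

/-- The triple `(B, iA, iS)` is a universal C⋆-algebra for the class `Cov` of pairs `(π, V)` on
Hilbert spaces (in the universe `w`). -/
structure IsUniversalAlgebra.{w, x, y, z} {A : Type x} {S : Type y} {B : Type z}
    [NonUnitalCStarAlgebra A] [AddCommMonoid S] [NonUnitalCStarAlgebra B]
    (Cov : ∀ (H : Type w) [NormedAddCommGroup H] [InnerProductSpace ℂ H] [CompleteSpace H],
      (A →⋆ₙₐ[ℂ] (H →L[ℂ] H)) → (S → (H →L[ℂ] H)) → Prop)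
    (iA : A →⋆ₙₐ[ℂ] B) (iS : S → 𝓜(ℂ, B)) : Prop where
  nondegenerate : IsNondegenerateHom iA
  isRep : IsSemigroupRep iS
  /-- non-degenerate representations of `B` give pairs in the class -/
  covariant : ∀ (H : Type w) [NormedAddCommGroup H] [InnerProductSpace ℂ H] [CompleteSpace H]
    (σ : B →⋆ₙₐ[ℂ] (H →L[ℂ] H)), IsNondegenerateRep σ →
      ∃ σbar : 𝓜(ℂ, B) →⋆ₐ[ℂ] (H →L[ℂ] H), IsMultiplierExtension σ σbar ∧
        Cov H (σ.comp iA) (fun s => σbar (iS s))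
  /-- pairs in the class factor through `B` -/
  universal : ∀ (H : Type w) [NormedAddCommGroup H] [InnerProductSpace ℂ H] [CompleteSpace H]
    (π : A →⋆ₙₐ[ℂ] (H →L[ℂ] H)) (V : S → (H →L[ℂ] H)), Cov H π V →
      ∃ (σ : B →⋆ₙₐ[ℂ] (H →L[ℂ] H)) (σbar : 𝓜(ℂ, B) →⋆ₐ[ℂ] (H →L[ℂ] H)),
        IsMultiplierExtension σ σbar ∧ σ.comp iA = π ∧ ∀ s, σbar (iS s) = V s
  /-- `B` is generated by the elements `iA(a) iS(s)` -/
  generated : Dense (NonUnitalStarAlgebra.adjoin ℂ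
    {x : B | ∃ (a : A) (s : S), multRight (iA a) (iS s) = x} : Set B)

/-- `(B, iA, iS)` is a Toeplitz crossed product for `(A, S, α, L)`. -/
def IsToeplitzCrossedProduct.{w, x, y, z} {A : Type x} {S : Type y} {B : Type z}
    [NonUnitalCStarAlgebra A] [AddCommMonoid S] [NonUnitalCStarAlgebra B]
    (α : S → A →⋆ₙₐ[ℂ] A) (L : S → A → A) (iA : A →⋆ₙₐ[ℂ] B) (iS : S → 𝓜(ℂ, B)) : Prop :=
  IsUniversalAlgebra.{w} (fun H _ _ _ π V => IsToeplitzCovariant α L H π V) iA iS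

/-- `(B, iA, iS)` is a semigroup crossed product `A ⋊_α S`. -/
def IsSemigroupCrossedProduct.{w, x, y, z} {A : Type x} {S : Type y} {B : Type z}
    [NonUnitalCStarAlgebra A] [AddCommMonoid S] [NonUnitalCStarAlgebra B]
    (α : S → A →⋆ₙₐ[ℂ] A) (iA : A →⋆ₙₐ[ℂ] B) (iS : S → 𝓜(ℂ, B)) : Prop :=
  IsUniversalAlgebra.{w} (fun H _ _ _ π V => IsIsometricCovariant α H π V) iA iS

end Representations

/-! ### Redundancies and the crossed product by endomorphisms and transfer operators -/

section Redundancies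

variable {A S B : Type*} [NonUnitalCStarAlgebra A] [AddCommMonoid S] [NonUnitalCStarAlgebra B]

/-- The closed linear span of `iA(A α_s(A) A)`. -/
def rangeIdealImage (α : S → A →⋆ₙₐ[ℂ] A) (iA : A →⋆ₙₐ[ℂ] B) (s : S) : Set B :=
  closure (Submodule.span ℂ {x : B | ∃ a b c : A, iA (a * α s b * c) = x} : Set B)

/-- The closed linear span of `iA(A) iS(s) iS(s)⋆ iA(A)`. -/
def compactImage (iA : A →⋆ₙₐ[ℂ] B) (iS : S → 𝓜(ℂ, B)) (s : S) : Set B :=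
  closure (Submodule.span ℂ
    {x : B | ∃ a b : A, multRight (iA a) (iS s * star (iS s)) * iA b = x} : Set B)

/-- `(a, k)` is a redundancy (for the semigroup element `s`). -/
structure IsRedundancy (iA : A →⋆ₙₐ[ℂ] B) (iS : S → 𝓜(ℂ, B)) (s : S) (a k : B) : Prop where
  left_mem : a ∈ Set.range iA
  right_mem : k ∈ compactImage iA iS s
  eq : ∀ b : A, a * multRight (iA b) (iS s) = k * multRight (iA b) (iS s)

/-- The closed two-sided ideal generated by the differences `a - k` of the redundancies `(a, k)`
with `a` in the closed span of `iA(A α_s(A) A)`. -/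
def redundancyIdeal (α : S → A →⋆ₙₐ[ℂ] A) (iA : A →⋆ₙₐ[ℂ] B) (iS : S → 𝓜(ℂ, B)) :
    ClosedIdeal B :=
  ClosedIdeal.span {x : B | ∃ (s : S) (a k : B), IsRedundancy iA iS s a k ∧
    a ∈ rangeIdealImage α iA s ∧ a - k = x}

/-- The crossed product `A ⋊_{α,L} S`, as the quotient of the Toeplitz crossed product
`(B, iA, iS)` of `(A, S, α, L)` by the ideal of redundancies. -/
abbrev TransferCrossedProduct (α : S → A →⋆ₙₐ[ℂ] A) (iA : A →⋆ₙₐ[ℂ] B) (iS : S → 𝓜(ℂ, B)) :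
    Type _ :=
  (redundancyIdeal α iA iS).Quotient

end Redundancies

universe u v

/-! ### Calculus of multipliers -/

section MultiplierCalculus

variable {A : Type*} [NonUnitalCStarAlgebra A]

/-! Write p_s for the projection ᾱ_s(1). Hereditary range forces p_s A p_s = α_s(A): for b ≥ 0 the
elements α_s(u) b α_s(u) tend to p_s b p_s and lie below ‖b‖ α_s(u²)
(`IsStrictExtension.corner_mem_range`). So L_s is compression to this corner followed by α_s⁻¹. Part
(1) then reduces to three facts: p_s fixes α_s(A), injective homomorphisms are isometric and reflect
positivity, and p_{s+t} = ᾱ_s(p_t). The last follows from uniqueness of strict extensions.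

For part (2) the two classes of pairs are compared. If V_s intertwines π and π ∘ α_s, then V_s* sees
A only through p_s A. Hence a covariant pair satisfies V_s* π(a) V_s = V_s* π(p_s a p_s) V_s =
π(L_s(a)), so it is Toeplitz covariant. Conversely L_s ∘ α_s = id makes every Toeplitz covariant
pair isometric. The classes therefore differ only by the relation V_s π(b) V_s* = π(α_s(b)).

This relation is what the redundancies impose. On one side (i_A(α_s(b)), i_S(s) i_A(b) i_S(s)*) is a
redundancy with an admissible first entry (`IsToeplitzCrossedProduct.isRedundancy`). On the other
side, take an admissible redundancy in a covariant representation. Both entries land in the closed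
span J of π(A α_s(A) A), their difference z annihilates π(A) V_s, so z J* = 0 and z z* = 0
(`map_eq_of_isRedundancy`). Faithful representations of the quotient and of A ⋊_α S, supplied by the
GNS construction, turn this into an isomorphism.

Existence of both universal algebras is one argument (`exists_universalAlgebra`). Isometries are
uniformly bounded, so pairs can be summed over a set of indices large enough to attain all norms of
formal ⋆-polynomials. The C⋆-algebra generated by the operators π(a) V_s of the resulting dominating
pair is universal. The V_s multiply it because V_t* π(a) is a norm limit of π(u) V_t* π(a). -/

theorem multiplierCoe_mul (a b : A) : ((a * b : A) : 𝓜(ℂ, A)) = a * b :=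
  map_mul (DoubleCentralizer.coeHom (𝕜 := ℂ) (A := A)) a b

theorem multiplierCoe_star (a : A) : ((star a : A) : 𝓜(ℂ, A)) = star (a : 𝓜(ℂ, A)) :=
  map_star (DoubleCentralizer.coeHom (𝕜 := ℂ) (A := A)) a

theorem multLeft_mul (m : 𝓜(ℂ, A)) (a b : A) : multLeft m (a * b) = multLeft m a * b :=
  multiplierCoe_injective <| by
    simp only [coe_multLeft, multiplierCoe_mul, mul_assoc]

theorem mul_multRight (a b : A) (m : 𝓜(ℂ, A)) : multRight (a * b) m = a * multRight b m :=
  multiplierCoe_injective <| by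
    simp only [coe_multRight, multiplierCoe_mul, mul_assoc]

theorem multRight_mul_eq (a b : A) (m : 𝓜(ℂ, A)) : multRight a m * b = a * multLeft m b :=
  m.central a b

theorem multRight_multLeft (m n : 𝓜(ℂ, A)) (a : A) :
    multRight (multLeft m a) n = multLeft m (multRight a n) :=
  multiplierCoe_injective <| by
    simp only [coe_multRight, coe_multLeft, mul_assoc]

theorem multLeft_mul_mult (m n : 𝓜(ℂ, A)) (a : A) :
    multLeft (m * n) a = multLeft m (multLeft n a) := rfl

theorem multLeft_one (a : A) : multLeft (1 : 𝓜(ℂ, A)) a = a := rfl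

theorem multLeft_coe (a b : A) : multLeft (a : 𝓜(ℂ, A)) b = a * b := rfl

theorem star_multLeft (m : 𝓜(ℂ, A)) (a : A) :
    star (multLeft m a) = multRight (star a) (star m) :=
  multiplierCoe_injective <| by
    simp only [coe_multRight, coe_multLeft, multiplierCoe_star, star_mul]

theorem star_multRight (m : 𝓜(ℂ, A)) (a : A) :
    star (multRight a m) = multLeft (star m) (star a) :=
  multiplierCoe_injective <| by
    simp only [coe_multRight, coe_multLeft, multiplierCoe_star, star_mul]

theorem continuous_multLeft (m : 𝓜(ℂ, A)) : Continuous (multLeft m) := m.fst.continuous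

theorem continuous_multRight (m : 𝓜(ℂ, A)) : Continuous (fun a : A => multRight a m) :=
  m.snd.continuous

theorem norm_multLeft_le (m : 𝓜(ℂ, A)) (a : A) : ‖multLeft m a‖ ≤ ‖m‖ * ‖a‖ := by
  rw [← DoubleCentralizer.norm_fst]; exact m.fst.le_opNorm a

theorem norm_multRight_le (m : 𝓜(ℂ, A)) (a : A) : ‖multRight a m‖ ≤ ‖m‖ * ‖a‖ := by
  rw [← DoubleCentralizer.norm_snd]; exact m.snd.le_opNorm a

theorem IsStrictExtension.star_map_one (β : 𝓜(ℂ, A) →⋆ₙₐ[ℂ] 𝓜(ℂ, A)) : star (β 1) = β 1 := by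
  rw [← map_star, star_one]

end MultiplierCalculus

/-! ### Homomorphisms of C⋆-algebras: continuity, closed range, positivity. -/

theorem NonUnitalStarAlgHom.continuous_of_cstar {A B : Type*} [NonUnitalCStarAlgebra A]
    [NonUnitalCStarAlgebra B] (φ : A →⋆ₙₐ[ℂ] B) : Continuous φ :=
  AddMonoidHomClass.continuous_of_bound φ 1 fun a => by
    simpa using NonUnitalStarAlgHom.norm_apply_le φ a

theorem NonUnitalStarAlgHom.isClosed_range_of_injective {A B : Type*} [NonUnitalCStarAlgebra A]
    [NonUnitalCStarAlgebra B] (φ : A →⋆ₙₐ[ℂ] B) (hφ : Function.Injective φ) :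
    IsClosed (Set.range φ) :=
  (NonUnitalStarAlgHom.isometry φ hφ).isClosedEmbedding.isClosed_range

section Positivity

variable {A : Type*} [NonUnitalCStarAlgebra A] [PartialOrder A] [StarOrderedRing A]

/-- Injective homomorphisms of C⋆-algebras reflect positivity. -/
theorem nonneg_of_map_nonneg {α : A →⋆ₙₐ[ℂ] A} (hinj : Function.Injective α) {x : A}
    (hx : 0 ≤ α x) : 0 ≤ x := by
  have hsa : IsSelfAdjoint x := hinj (by rw [map_star]; exact (IsSelfAdjoint.of_nonneg hx).star_eq)
  have hy : 0 ≤ x⁻ := CFC.negPart_nonneg x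
  have hys : star (x⁻) = x⁻ := (IsSelfAdjoint.of_nonneg hy).star_eq
  -- The image of x⁻ x x⁻ = -(x⁻)³ is positive because α x is, and negative because (x⁻)³ ≥ 0.
  -- Injectivity then gives (x⁻)³ = 0, hence x⁻ = 0.
  have h1 : x⁻ * x * x⁻ = -(x⁻ * x⁻ * x⁻) := by
    have : x⁻ * x = -(x⁻ * x⁻) := by
      calc x⁻ * x = x⁻ * (x⁺ - x⁻) := by rw [CFC.posPart_sub_negPart x hsa]
        _ = _ := by rw [mul_sub, CFC.negPart_mul_posPart, zero_sub]
    rw [this, neg_mul]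
  have hmono : ∀ z : A, 0 ≤ z → 0 ≤ α z := by
    intro z hz
    obtain ⟨c, rfl⟩ := CStarAlgebra.nonneg_iff_eq_star_mul_self.1 hz
    rw [map_mul, map_star]
    exact star_mul_self_nonneg _
  have h2 : 0 ≤ α (x⁻ * x * x⁻) := by
    rw [map_mul, map_mul]
    nth_rewrite 1 [← hys]
    rw [map_star]
    exact star_left_conjugate_nonneg hx _
  have h3 : 0 ≤ α (x⁻ * x⁻ * x⁻) := by
    refine hmono _ ?_
    nth_rewrite 1 [← hys]
    exact star_left_conjugate_nonneg hy _
  rw [h1, map_neg, neg_nonneg] at h2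
  have h4 : x⁻ * x⁻ * x⁻ = 0 := hinj (by rw [map_zero]; exact le_antisymm h2 h3)
  have h5 : x⁻ * x⁻ = 0 := by
    have : star (x⁻ * x⁻) * (x⁻ * x⁻) = 0 := by
      rw [star_mul, hys, ← mul_assoc, h4, zero_mul]
    exact (CStarRing.star_mul_self_eq_zero_iff _).1 this
  have h6 : x⁻ = 0 := (CStarRing.star_mul_self_eq_zero_iff _).1 (by rw [hys, h5])
  rw [← CFC.posPart_sub_negPart x hsa, h6, sub_zero]
  exact CFC.posPart_nonneg x

end Positivity

/-! ### The transfer operators of an action with hereditary ranges -/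

section Transfer

variable {A : Type*} [NonUnitalCStarAlgebra A] [PartialOrder A]

namespace IsStrictExtension

variable {α : A →⋆ₙₐ[ℂ] A} {β : 𝓜(ℂ, A) →⋆ₙₐ[ℂ] 𝓜(ℂ, A)}

theorem multLeft_apply (h : IsStrictExtension α β) (a : A) : multLeft (β 1) (α a) = α a :=
  multiplierCoe_injective <| by
    simp only [coe_multLeft, ← h.1, ← map_mul, one_mul]

theorem multRight_apply (h : IsStrictExtension α β) (a : A) : multRight (α a) (β 1) = α a :=
  multiplierCoe_injective <| by
    simp only [coe_multRight, ← h.1, ← map_mul, mul_one]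

/-- Combined with uniqueness of strict extensions, this yields ᾱ_{s+t}(1) = ᾱ_s(ᾱ_t(1)). For the
strict limit, x may be replaced by β(1)x and then by a nearby α(v)x. There α(α'(u))α(v)x =
α(α'(u)v)x, and α'(u)v converges by strictness for α'. -/
theorem comp [StarOrderedRing A] {α' : A →⋆ₙₐ[ℂ] A} {β' : 𝓜(ℂ, A) →⋆ₙₐ[ℂ] 𝓜(ℂ, A)}
    (h : IsStrictExtension α β) (h' : IsStrictExtension α' β') :
    IsStrictExtension (α.comp α') (β.comp β') := by
  refine ⟨fun a => by simp [h.1, h'.1], ?_⟩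
  obtain ⟨l, hl, hlim⟩ := h.2
  obtain ⟨l', hl', hlim'⟩ := h'.2
  have := hl.neBot
  have hbd : ∀ᶠ u in l', ‖α (α' u)‖ ≤ 1 := hl'.eventually_norm.mono fun u hu =>
    (NonUnitalStarAlgHom.norm_apply_le α _).trans ((NonUnitalStarAlgHom.norm_apply_le α' _).trans hu)
  have key : ∀ x : A, Tendsto (fun u => α (α' u) * x) l' (𝓝 (multLeft (β (β' 1)) x)) := by
    intro x
    have h1 : multLeft (β (β' 1)) x = multLeft (β (β' 1)) (multLeft (β 1) x) := by
      rw [← multLeft_mul_mult, ← map_mul, mul_one]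
    have h2 : ∀ u, α (α' u) * x = α (α' u) * multLeft (β 1) x := by
      intro u
      rw [← multRight_mul_eq, h.multRight_apply]
    simp only [h1, h2]
    rw [Metric.tendsto_nhds]
    intro ε hε
    -- C bounds d ↦ α(α'(u))d - β(β'(1))d, since ‖α(α'(u))‖ ≤ 1 eventually.
    set C := ‖β (β' 1)‖ + 1 with hC
    have hCpos : 0 < C := by positivity
    obtain ⟨v, hv⟩ := ((Metric.tendsto_nhds.1 (hlim x).1) (ε / (2 * (C + 1))) (by positivity)).exists
    have h3 : Tendsto (fun u => α (α' u) * (α v * x)) l'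
        (𝓝 (multLeft (β (β' 1)) (α v * x))) := by
      have e1 : multLeft (β (β' 1)) (α v * x) = α (multLeft (β' 1) v) * x := by
        rw [multLeft_mul]
        congr 1
        refine multiplierCoe_injective ?_
        simp only [coe_multLeft, ← h.1, ← map_mul]
      simp only [e1, ← mul_assoc, ← map_mul]
      exact ((((NonUnitalStarAlgHom.continuous_of_cstar α).tendsto _).comp
        (hlim' v).1)).mul_const x
    filter_upwards [hbd, (Metric.tendsto_nhds.1 h3) (ε / 2) (by positivity)] with u hu1 hu2
    rw [dist_eq_norm] at hv hu2 ⊢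
    set d := α v * x - multLeft (β 1) x with hd
    have e2 : α (α' u) * multLeft (β 1) x - multLeft (β (β' 1)) (multLeft (β 1) x) =
        (α (α' u) * (α v * x) - multLeft (β (β' 1)) (α v * x)) -
          (α (α' u) * d - multLeft (β (β' 1)) d) := by
      have : multLeft (β (β' 1)) d =
          multLeft (β (β' 1)) (α v * x) - multLeft (β (β' 1)) (multLeft (β 1) x) :=
        map_sub (β (β' 1)).fst _ _
      rw [this, hd, mul_sub]
      abel
    rw [e2]
    have e3 : ‖α (α' u) * d - multLeft (β (β' 1)) d‖ ≤ C * ‖d‖ := by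
      refine (norm_sub_le _ _).trans ?_
      have := norm_multLeft_le (β (β' 1)) d
      have h4 : ‖α (α' u) * d‖ ≤ 1 * ‖d‖ := (norm_mul_le _ _).trans (by gcongr)
      rw [hC]; linarith
    have e4 : C * ‖d‖ ≤ ε / 2 := by
      have : C * ‖d‖ ≤ (C + 1) * (ε / (2 * (C + 1))) := by gcongr; linarith
      refine this.trans (le_of_eq ?_)
      field_simp
    refine (norm_sub_le _ _).trans_lt ?_
    linarith
  -- The right-hand limit is the adjoint of the left-hand one at x*, because the u are eventually
  -- self-adjoint.
  refine ⟨l', hl', fun x => ⟨key x, ?_⟩⟩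
  have h5 := (key (star x)).star
  rw [star_multLeft, star_star, ← map_star, ← map_star, star_one] at h5
  refine h5.congr' ?_
  filter_upwards [hl'.eventually_star_eq] with u hu
  rw [star_mul, star_star, ← map_star, ← map_star, hu]
  rfl

variable [StarOrderedRing A]

/-- The corner `ᾱ(1) A ᾱ(1)` is contained in a hereditary range. -/
theorem corner_mem_range (h : IsStrictExtension α β) (hinj : Function.Injective α)
    (hher : HasHereditaryRange α) (a : A) :
    multRight (multLeft (β 1) a) (β 1) ∈ Set.range α := by
  obtain ⟨l, hl, hlim⟩ := h.2
  have := hl.neBot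
  have hcl := NonUnitalStarAlgHom.isClosed_range_of_injective α hinj
  have hpos : ∀ b : A, 0 ≤ b → multRight (multLeft (β 1) b) (β 1) ∈ Set.range α := by
    intro b hb
    -- The compressed element is approximated by elements to which hereditarity applies. The range
    -- is closed, so the limit stays in it.
    have hT : Tendsto (fun u => α u * b * α u) l (𝓝 (multRight (multLeft (β 1) b) (β 1))) := by
      have t1 : Tendsto (fun u => α u * (multRight b (β 1))) l
          (𝓝 (multRight (multLeft (β 1) b) (β 1))) := by
        rw [multRight_multLeft]; exact (hlim _).1
      have t2 : Tendsto (fun u => α u * (b * α u - multRight b (β 1))) l (𝓝 0) := by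
        have := (hlim b).2
        rw [tendsto_iff_norm_sub_tendsto_zero] at this
        refine squeeze_zero_norm' ?_ this
        filter_upwards [hl.eventually_norm] with u hu
        refine (norm_mul_le _ _).trans (mul_le_of_le_one_left (norm_nonneg _) ?_)
        exact (NonUnitalStarAlgHom.norm_apply_le α u).trans hu
      have := t1.add t2
      rw [add_zero] at this
      refine this.congr fun u => ?_
      rw [mul_sub, mul_assoc]; abel
    refine hcl.mem_of_tendsto hT ?_
    filter_upwards [hl.eventually_star_eq] with u hu
    have hαu : star (α u) = α u := by rw [← map_star, hu]
    -- The dominating element comes from α(u) b α(u) ≤ ‖b‖ α(u)α(u).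
    refine hher _ ((‖b‖ : ℂ) • (star u * u)) ?_ ?_
    · have := star_left_conjugate_nonneg hb (α u)
      rwa [hαu] at this
    · have := CStarAlgebra.star_left_conjugate_le_norm_smul (a := α u) (b := b)
        (IsSelfAdjoint.of_nonneg hb)
      rw [map_smul, map_mul, map_star, Complex.coe_smul]
      rw [hαu] at this ⊢
      exact this
  -- Compression is linear and positive elements span A, so the positive case is enough.
  let T : A →ₗ[ℂ] A := (β 1).snd.toLinearMap ∘ₗ (β 1).fst.toLinearMap
  have hle : Submodule.span ℂ {b : A | 0 ≤ b} ≤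
      (LinearMap.range (α : A →ₗ[ℂ] A)).comap T := by
    rw [Submodule.span_le]
    intro b hb
    obtain ⟨c, hc⟩ := hpos b hb
    exact ⟨c, hc⟩
  rw [CStarAlgebra.span_nonneg] at hle
  obtain ⟨c, hc⟩ := hle (Submodule.mem_top : a ∈ ⊤)
  exact ⟨c, hc⟩

end IsStrictExtension

theorem IsExtendible.isStrictExtension {α : A →⋆ₙₐ[ℂ] A} (h : IsExtendible α) :
    IsStrictExtension α h.extension := h.choose_spec

variable [StarOrderedRing A] {S : Type*} {α : S → A →⋆ₙₐ[ℂ] A} (hext : ∀ s, IsExtendible (α s))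

/-- The defining property of the transfer operators. -/
theorem apply_hereditaryTransfer (hinj : ∀ s, Function.Injective (α s))
    (hher : ∀ s, HasHereditaryRange (α s)) (s : S) (a : A) :
    α s (hereditaryTransfer α hext s a) =
      multRight (multLeft ((hext s).extension 1) a) ((hext s).extension 1) :=
  Function.invFun_eq
    ((hext s).isStrictExtension.corner_mem_range (hinj s) (hher s) a)

theorem hereditaryTransfer_apply (hinj : ∀ s, Function.Injective (α s))
    (hher : ∀ s, HasHereditaryRange (α s)) (s : S) (a : A) :
    hereditaryTransfer α hext s (α s a) = a := by
  apply hinj s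
  rw [apply_hereditaryTransfer hext hinj hher, (hext s).isStrictExtension.multLeft_apply,
    (hext s).isStrictExtension.multRight_apply]

/-- Since ᾱ_s(1) fixes α_s(a) on both sides, compressing x α_s(a) is the same as compressing x and
then multiplying by α_s(a). Injectivity of α_s removes the outer α_s. -/
theorem hereditaryTransfer_mul_right (hinj : ∀ s, Function.Injective (α s))
    (hher : ∀ s, HasHereditaryRange (α s)) (s : S) (a x : A) :
    hereditaryTransfer α hext s (x * α s a) = hereditaryTransfer α hext s x * a := by
  apply hinj s
  rw [map_mul, apply_hereditaryTransfer hext hinj hher, apply_hereditaryTransfer hext hinj hher,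
    multRight_mul_eq, (hext s).isStrictExtension.multLeft_apply, multLeft_mul, mul_multRight,
    (hext s).isStrictExtension.multRight_apply]

theorem hereditaryTransfer_mul_left (hinj : ∀ s, Function.Injective (α s))
    (hher : ∀ s, HasHereditaryRange (α s)) (s : S) (a x : A) :
    hereditaryTransfer α hext s (α s a * x) = a * hereditaryTransfer α hext s x := by
  apply hinj s
  rw [map_mul, apply_hereditaryTransfer hext hinj hher, apply_hereditaryTransfer hext hinj hher,
    multLeft_mul, (hext s).isStrictExtension.multLeft_apply, mul_multRight, multRight_multLeft,
    ← multRight_mul_eq, (hext s).isStrictExtension.multRight_apply]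

theorem norm_hereditaryTransfer_le (hinj : ∀ s, Function.Injective (α s))
    (hher : ∀ s, HasHereditaryRange (α s)) (s : S) (x : A) :
    ‖hereditaryTransfer α hext s x‖ ≤ ‖(hext s).extension 1‖ * (‖(hext s).extension 1‖ * ‖x‖) := by
  rw [← NonUnitalStarAlgHom.norm_map (α s) (hinj s), apply_hereditaryTransfer hext hinj hher]
  refine (norm_multRight_le _ _).trans ?_
  gcongr
  exact norm_multLeft_le _ _

theorem isLinearMap_hereditaryTransfer (hinj : ∀ s, Function.Injective (α s))
    (hher : ∀ s, HasHereditaryRange (α s)) (s : S) :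
    IsLinearMap ℂ (hereditaryTransfer α hext s) where
  map_add x y := by
    apply hinj s
    simp only [map_add, apply_hereditaryTransfer hext hinj hher, multLeft, multRight]
  map_smul c x := by
    apply hinj s
    simp only [map_smul, apply_hereditaryTransfer hext hinj hher, multLeft, multRight]

/-- The transfer operator as a continuous linear map. -/
theorem exists_hereditaryTransfer_clm (hinj : ∀ s, Function.Injective (α s))
    (hher : ∀ s, HasHereditaryRange (α s)) (s : S) :
    ∃ T : A →L[ℂ] A, ∀ a, T a = hereditaryTransfer α hext s a :=
  ⟨LinearMap.mkContinuous ((isLinearMap_hereditaryTransfer hext hinj hher s).mk' _)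
    (‖(hext s).extension 1‖ * ‖(hext s).extension 1‖) fun x => by
      rw [mul_assoc]; exact norm_hereditaryTransfer_le hext hinj hher s x, fun _ => rfl⟩

theorem continuous_hereditaryTransfer (hinj : ∀ s, Function.Injective (α s))
    (hher : ∀ s, HasHereditaryRange (α s)) (s : S) : Continuous (hereditaryTransfer α hext s) := by
  obtain ⟨T, hT⟩ := exists_hereditaryTransfer_clm hext hinj hher s
  rw [← funext hT]
  exact T.continuous

/-- The multiplier L̄_s(m) is given by a ↦ L_s(m α_s(a)) on the left and a ↦ L_s(α_s(a) m) on the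
right. The two module identities over α_s(A) are its centrality condition, and the transfer identity
is the definition of its right action. -/
theorem exists_extension_hereditaryTransfer (hinj : ∀ s, Function.Injective (α s))
    (hher : ∀ s, HasHereditaryRange (α s)) (s : S) :
    ∃ Lbar : 𝓜(ℂ, A) →L[ℂ] 𝓜(ℂ, A),
    (∀ a : A, Lbar (a : 𝓜(ℂ, A)) = ((hereditaryTransfer α hext s a : A) : 𝓜(ℂ, A))) ∧
    ∀ (a : A) (u : 𝓜(ℂ, A)),
      hereditaryTransfer α hext s (multRight (α s a) u) = multRight a (Lbar u) := by
  obtain ⟨T, hT⟩ := exists_hereditaryTransfer_clm hext hinj hher s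
  have hl := hereditaryTransfer_mul_left hext hinj hher s
  have hr := hereditaryTransfer_mul_right hext hinj hher s
  let αc : A →L[ℂ] A := ⟨(α s : A →ₗ[ℂ] A), NonUnitalStarAlgHom.continuous_of_cstar (α s)⟩
  let Lb : 𝓜(ℂ, A) → 𝓜(ℂ, A) := fun m =>
    { toProd := (T.comp (m.fst.comp αc), T.comp (m.snd.comp αc))
      central := fun x y => by
        change T (multRight (α s x) m) * y = x * T (multLeft m (α s y))
        rw [hT, hT, ← hl, ← hr, multRight_mul_eq] }
  let Ll : 𝓜(ℂ, A) →ₗ[ℂ] 𝓜(ℂ, A) :=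
    { toFun := Lb
      map_add' := fun m n => by
        refine DoubleCentralizer.ext _ _ _ _ (Prod.ext (ContinuousLinearMap.ext fun y => ?_)
          (ContinuousLinearMap.ext fun y => ?_))
        · exact map_add T _ _
        · exact map_add T _ _
      map_smul' := fun c m => by
        refine DoubleCentralizer.ext _ _ _ _ (Prod.ext (ContinuousLinearMap.ext fun y => ?_)
          (ContinuousLinearMap.ext fun y => ?_))
        · exact map_smul T c _
        · exact map_smul T c _ }
  refine ⟨Ll.mkContinuous (‖T‖ * ‖αc‖) fun m => ?_, fun a => ?_, fun a u => ?_⟩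
  · rw [← DoubleCentralizer.norm_fst]
    change ‖T.comp (m.fst.comp αc)‖ ≤ _
    refine (T.opNorm_comp_le _).trans ?_
    rw [mul_assoc, mul_comm ‖αc‖]
    gcongr
    rw [← DoubleCentralizer.norm_fst]
    exact ContinuousLinearMap.opNorm_comp_le _ _
  · refine multiplier_ext fun x => ?_
    change T (a * α s x) = hereditaryTransfer α hext s a * x
    rw [hT, hr]
  · change _ = T (multRight (α s a) u)
    rw [hT]

variable [AddCommMonoid S]

theorem extension_add_one (hα : IsEndomorphismAction α) (s t : S) :
    (hext (s + t)).extension 1 = (hext s).extension ((hext t).extension 1) := by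
  have h := (hext s).isStrictExtension.comp (hext t).isStrictExtension
  have e : (α s).comp (α t) = α (s + t) := by ext a; exact (hα.map_add s t a).symm
  rw [e] at h
  exact congrArg (fun φ => φ 1) ((hext (s + t)).isStrictExtension.unique h)

theorem isTransferAction_hereditaryTransfer (hα : IsEndomorphismAction α)
    (hinj : ∀ s, Function.Injective (α s)) (hher : ∀ s, HasHereditaryRange (α s)) :
    IsTransferAction α (hereditaryTransfer α hext) where
  map_zero a := by
    -- The identity of M(A) is a strict extension of α_0, so uniqueness applies.
    have h0 : (hext 0).extension 1 = 1 := by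
      have : IsStrictExtension (α 0) (NonUnitalStarAlgHom.id ℂ 𝓜(ℂ, A)) := by
        refine ⟨fun a => by simp [hα.map_zero], CStarAlgebra.approximateUnit A,
          CStarAlgebra.increasingApproximateUnit A, fun x => ⟨?_, ?_⟩⟩
        · simp only [hα.map_zero]
          exact (CStarAlgebra.increasingApproximateUnit A).tendsto_mul_right x
        · simp only [hα.map_zero]
          exact (CStarAlgebra.increasingApproximateUnit A).tendsto_mul_left x
      rw [(hext 0).isStrictExtension.unique this]
      rfl
    have := apply_hereditaryTransfer hext hinj hher 0 a
    rwa [h0, hα.map_zero] at this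
  map_add s t a := by
    apply hinj (s + t)
    -- The projection p_{t+s} = ᾱ_t(p_s) lies below p_t.
    have e1 : (hext (t + s)).extension 1 * (hext t).extension 1 = (hext (t + s)).extension 1 := by
      rw [extension_add_one hext hα, ← map_mul, mul_one]
    have e2 : (hext t).extension 1 * (hext (t + s)).extension 1 = (hext (t + s)).extension 1 := by
      rw [extension_add_one hext hα, ← map_mul, one_mul]
    -- Commutativity of S lets α_{s+t} be peeled off as α_t ∘ α_s, in the order in which L_s and L_t
    -- were applied. The result is p_{t+s} p_t a p_t p_{t+s}, from which p_t is absorbed.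
    have e3 : α (s + t) (hereditaryTransfer α hext s (hereditaryTransfer α hext t a)) =
        multRight (multLeft ((hext (t + s)).extension 1) a) ((hext (t + s)).extension 1) := by
      rw [add_comm, hα.map_add, apply_hereditaryTransfer hext hinj hher]
      refine multiplierCoe_injective ?_
      change ((α t _ : A) : 𝓜(ℂ, A)) = _
      have hp := congrArg (fun x : A => (x : 𝓜(ℂ, A))) (apply_hereditaryTransfer hext hinj hher t a)
      simp only [coe_multRight, coe_multLeft, ← (hext t).isStrictExtension.1, map_mul] at hp ⊢
      rw [hp, ← extension_add_one hext hα]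
      simp only [mul_assoc]
      rw [e2]
      simp only [← mul_assoc]
      rw [e1]
    rw [e3, apply_hereditaryTransfer hext hinj hher, add_comm]
  isLinear := isLinearMap_hereditaryTransfer hext hinj hher
  continuous := continuous_hereditaryTransfer hext hinj hher
  nonneg s a ha := by
    refine nonneg_of_map_nonneg (hinj s) ?_
    rw [apply_hereditaryTransfer hext hinj hher]
    obtain ⟨c, rfl⟩ := CStarAlgebra.nonneg_iff_eq_star_mul_self.1 ha
    -- With p = ᾱ_s(1) self-adjoint, p c*c p = (cp)*(cp).
    have : multRight (multLeft ((hext s).extension 1) (star c * c)) ((hext s).extension 1) =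
        star (multRight c ((hext s).extension 1)) * multRight c ((hext s).extension 1) := by
      rw [star_multRight, IsStrictExtension.star_map_one, multLeft_mul, mul_multRight]
    rw [this]
    exact star_mul_self_nonneg _
  exists_extension := exists_extension_hereditaryTransfer hext hinj hher

end Transfer

/-! ### Approximate units and non-degenerate representations -/

section Nondegenerate

theorem exists_approximateUnit (B : Type*) [NonUnitalCStarAlgebra B] :
    ∃ l : Filter B, l.IsApproximateUnit ∧ (∀ᶠ u in l, ‖u‖ ≤ 1) ∧ ∀ᶠ u in l, star u = u := by
  let _ : PartialOrder B := CStarAlgebra.spectralOrder B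
  have _ : StarOrderedRing B := CStarAlgebra.spectralOrderedRing B
  have h := CStarAlgebra.increasingApproximateUnit B
  exact ⟨CStarAlgebra.approximateUnit B, h.toIsApproximateUnit, h.eventually_norm,
    h.eventually_star_eq⟩

/-- Strong convergence of a bounded net of operators can be checked on a total set. -/
theorem tendsto_apply_of_dense_span {ι H K : Type*} [NormedAddCommGroup H] [NormedSpace ℂ H]
    [NormedAddCommGroup K] [NormedSpace ℂ K] {l : Filter ι} {T : ι → H →L[ℂ] K} {T' : H →L[ℂ] K}
    {C : ℝ} {s : Set H} (hs : Dense (Submodule.span ℂ s : Set H)) (hC : ∀ᶠ u in l, ‖T u‖ ≤ C)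
    (hT : ∀ x ∈ s, Tendsto (fun u => T u x) l (𝓝 (T' x))) (h : H) :
    Tendsto (fun u => T u h) l (𝓝 (T' h)) := by
  have hspan : ∀ x ∈ Submodule.span ℂ s, Tendsto (fun u => T u x) l (𝓝 (T' x)) := by
    intro x hx
    induction hx using Submodule.span_induction with
    | mem x hx => exact hT x hx
    | zero => simpa using tendsto_const_nhds
    | add x y _ _ hx hy => simpa using hx.add hy
    | smul c x _ hx => simpa using hx.const_smul c
  rw [Metric.tendsto_nhds]
  intro ε hε
  -- M bounds the two operator norms together. The summand 1 makes it positive, and |C| avoids an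
  -- assumption on the sign of C.
  set M : ℝ := |C| + ‖T'‖ + 1 with hM
  have hMpos : 0 < M := by positivity
  obtain ⟨x, hx, hd⟩ := Metric.mem_closure_iff.1 (hs h) (ε / (2 * M)) (by positivity)
  filter_upwards [hC, Metric.tendsto_nhds.1 (hspan x hx) (ε / 2) (by positivity)] with u h1 h2
  rw [dist_eq_norm] at hd h2 ⊢
  have e : T u h - T' h = T u (h - x) - T' (h - x) + (T u x - T' x) := by
    simp only [map_sub]; abel
  have e1 : ‖T u (h - x)‖ ≤ |C| * ‖h - x‖ :=
    (T u).le_of_opNorm_le (h1.trans (le_abs_self C)) _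
  have e2 : ‖T' (h - x)‖ ≤ ‖T'‖ * ‖h - x‖ := T'.le_opNorm _
  have e3 : M * ‖h - x‖ ≤ ε / 2 := by
    calc M * ‖h - x‖ ≤ M * (ε / (2 * M)) := by gcongr
      _ = ε / 2 := by field_simp
  rw [e]
  have e4 := norm_add_le (T u (h - x) - T' (h - x)) (T u x - T' x)
  have e5 := norm_sub_le (T u (h - x)) (T' (h - x))
  have e6 : (|C| + ‖T'‖) * ‖h - x‖ ≤ M * ‖h - x‖ := by
    gcongr; rw [hM]; linarith
  linarith

variable {B H : Type*} [NonUnitalCStarAlgebra B] [NormedAddCommGroup H]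
  [InnerProductSpace ℂ H] [CompleteSpace H] {σ : B →⋆ₙₐ[ℂ] (H →L[ℂ] H)}

theorem tendsto_map_mul_apply (σ : B →⋆ₙₐ[ℂ] (H →L[ℂ] H)) {l : Filter B} {x y : B} {f : B → B}
    (hf : Tendsto (fun u => f u * x) l (𝓝 y)) (h : H) :
    Tendsto (fun u => σ (f u) (σ x h)) l (𝓝 (σ y h)) := by
  have h1 := ((NonUnitalStarAlgHom.continuous_of_cstar σ).tendsto _).comp hf
  have h2 := (ContinuousLinearMap.apply ℂ H h).continuous.tendsto (σ y)
  refine (h2.comp h1).congr fun u => ?_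
  simp

namespace IsNondegenerateRep

theorem tendsto_apply (hσ : IsNondegenerateRep σ) {l : Filter B} (hl : l.IsApproximateUnit)
    (hl1 : ∀ᶠ u in l, ‖u‖ ≤ 1) (h : H) : Tendsto (fun u => σ u h) l (𝓝 h) := by
  refine tendsto_apply_of_dense_span (T := fun u => σ u) (T' := ContinuousLinearMap.id ℂ H)
    (C := 1) hσ (hl1.mono fun u hu => (NonUnitalStarAlgHom.norm_apply_le σ u).trans hu) ?_ h
  rintro _ ⟨a, k, rfl⟩
  exact tendsto_map_mul_apply σ (f := id) (hl.tendsto_mul_right a) k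

theorem op_ext {K : Type*} [NormedAddCommGroup K] [NormedSpace ℂ K] (hσ : IsNondegenerateRep σ)
    {T T' : H →L[ℂ] K} (h : ∀ b k, T (σ b k) = T' (σ b k)) : T = T' := by
  refine ContinuousLinearMap.ext_on hσ ?_
  rintro _ ⟨b, k, rfl⟩
  exact h b k

/-- The values on σ(B)H are prescribed. A finite sum Σ σ(m b_i)k_i is the limit of σ(mu) applied to
Σ σ(b_i)k_i, and ‖mu‖ ≤ ‖m‖, so well-definedness and boundedness come out together. -/
theorem exists_operator (hσ : IsNondegenerateRep σ) (m : 𝓜(ℂ, B)) :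
    ∃ T : H →L[ℂ] H, ∀ b k, T (σ b k) = σ (multLeft m b) k := by
  -- Formal sums serve as the domain, so nothing has to be well defined before the norm estimate is
  -- available.
  let e : (B × H →₀ ℂ) →ₗ[ℂ] H := Finsupp.linearCombination ℂ (fun p : B × H => σ p.1 p.2)
  let f : (B × H →₀ ℂ) →ₗ[ℂ] H :=
    Finsupp.linearCombination ℂ (fun p : B × H => σ (multLeft m p.1) p.2)
  have hr : Set.range (fun p : B × H => σ p.1 p.2) = {x : H | ∃ (a : B) (h : H), σ a h = x} := by
    ext x; simp
  have hdense : DenseRange e := by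
    have : Set.range e = (Submodule.span ℂ {x : H | ∃ (a : B) (h : H), σ a h = x} : Set H) := by
      rw [← hr, ← Finsupp.range_linearCombination, LinearMap.coe_range]
    rw [DenseRange, this]
    exact hσ
  obtain ⟨l, hl, hl1, -⟩ := exists_approximateUnit B
  have := hl.neBot
  have hlim : ∀ x, Tendsto (fun u => σ (multLeft m u) (e x)) l (𝓝 (f x)) := by
    intro x
    induction x using Finsupp.induction_linear with
    | zero => simp
    | add x y hx hy => simpa using hx.add hy
    | single p c =>
      simp only [e, f, Finsupp.linearCombination_single, map_smul]
      refine Tendsto.const_smul ?_ c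
      refine tendsto_map_mul_apply σ (f := multLeft m) ?_ p.2
      simp only [← multLeft_mul]
      exact ((continuous_multLeft m).tendsto _).comp (hl.tendsto_mul_right p.1)
  have hnorm : ∀ x, ‖f x‖ ≤ ‖m‖ * ‖e x‖ := by
    intro x
    refine le_of_tendsto (hlim x).norm ?_
    filter_upwards [hl1] with u hu
    refine (σ (multLeft m u)).le_of_opNorm_le ?_ _
    refine (NonUnitalStarAlgHom.norm_apply_le σ _).trans ((norm_multLeft_le m u).trans ?_)
    exact mul_le_of_le_one_right (norm_nonneg _) hu
  refine ⟨f.extendOfNorm e, fun b k => ?_⟩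
  have := LinearMap.extendOfNorm_eq hdense ⟨_, hnorm⟩ (Finsupp.single (b, k) 1)
  simpa [e, f, Finsupp.linearCombination_single] using this

/-- Non-degenerate representations extend to the multiplier algebra. -/
theorem exists_multiplierExtension (hσ : IsNondegenerateRep σ) :
    ∃ σbar : 𝓜(ℂ, B) →⋆ₐ[ℂ] (H →L[ℂ] H), IsMultiplierExtension σ σbar := by
  choose T hT using hσ.exists_operator
  refine ⟨{ toFun := T, map_one' := ?_, map_mul' := ?_, map_zero' := ?_, map_add' := ?_,
            commutes' := ?_, map_star' := ?_ }, ?_⟩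
  · exact hσ.op_ext fun b k => by rw [hT, multLeft_one]; rfl
  · intro m n
    exact hσ.op_ext fun b k => by
      rw [mul_apply_eq_comp, hT, hT, hT, multLeft_mul_mult]
  · exact hσ.op_ext fun b k => by
      rw [hT]
      change σ 0 k = 0
      simp
  · intro m n
    exact hσ.op_ext fun b k => by
      rw [add_apply, hT, hT, hT]
      change σ (multLeft m b + multLeft n b) k = _
      simp
  · intro c
    exact hσ.op_ext fun b k => by
      rw [hT, Algebra.algebraMap_eq_smul_one, Algebra.algebraMap_eq_smul_one]
      change σ (c • b) k = c • σ b k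
      simp
  · intro m
    refine hσ.op_ext fun b k => ?_
    rw [hT]
    refine ext_inner_right ℂ fun v => ?_
    -- Adjoints are compared as functionals, which need only be tested on the total set of vectors
    -- σ(c)w.
    have key : innerSL ℂ (σ (multLeft (star m) b) k) =
        innerSL ℂ ((star (T m)) (σ b k)) := by
      refine hσ.op_ext fun c w => ?_
      simp only [innerSL_apply_apply]
      rw [ContinuousLinearMap.star_eq_adjoint, ContinuousLinearMap.adjoint_inner_left, hT,
        ← ContinuousLinearMap.adjoint_inner_right, ← ContinuousLinearMap.adjoint_inner_right,
        ← ContinuousLinearMap.star_eq_adjoint, ← ContinuousLinearMap.star_eq_adjoint,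
        ← map_star, ← map_star, ← mul_apply_eq_comp, ← mul_apply_eq_comp,
        ← map_mul, ← map_mul, star_multLeft, star_star, multRight_mul_eq]
    exact congrArg (fun φ => φ v) key
  · intro b
    refine hσ.op_ext fun c k => ?_
    change T b (σ c k) = _
    rw [hT, multLeft_coe, map_mul]
    rfl

end IsNondegenerateRep

namespace IsMultiplierExtension

variable {σbar : 𝓜(ℂ, B) →⋆ₐ[ℂ] (H →L[ℂ] H)}

theorem mul_map (h : IsMultiplierExtension σ σbar) (m : 𝓜(ℂ, B)) (b : B) :
    σbar m * σ b = σ (multLeft m b) := by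
  rw [← h, ← h, coe_multLeft, map_mul]

theorem map_mul (h : IsMultiplierExtension σ σbar) (m : 𝓜(ℂ, B)) (b : B) :
    σ b * σbar m = σ (multRight b m) := by
  rw [← h, ← h, coe_multRight, _root_.map_mul]

end IsMultiplierExtension

end Nondegenerate

/-! ### Hilbert sums of operators and representations -/

section HilbertSum

variable {ι : Type*} {H : ι → Type*} [∀ i, NormedAddCommGroup (H i)]
  [∀ i, InnerProductSpace ℂ (H i)]

theorem exists_hilbertSum_operator (T : ∀ i, H i →L[ℂ] H i) {C : ℝ} (hC : ∀ i, ‖T i‖ ≤ C) :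
    ∃ D : lp H 2 →L[ℂ] lp H 2, ∀ f i, D f i = T i (f i) := by
  -- Coordinatewise comparison with C • f gives both square-summability and the norm bound.
  have hle : ∀ (f : lp H 2) i, ‖T i (f i)‖ ≤ ‖((C : ℂ) • f) i‖ := fun f i => by
    rw [lp.coeFn_smul, Pi.smul_apply, norm_smul, Complex.norm_real]
    exact (T i).le_of_opNorm_le ((hC i).trans (le_abs_self C)) _
  let D : lp H 2 →ₗ[ℂ] lp H 2 :=
    { toFun := fun f => ⟨fun i => T i (f i), (lp.memℓp ((C : ℂ) • f)).mono' (hle f)⟩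
      map_add' := fun f g => by
        ext i
        exact map_add (T i) (f i) (g i)
      map_smul' := fun c f => by
        ext i
        exact map_smul (T i) c (f i) }
  refine ⟨D.mkContinuous |C| fun f => ?_, fun f i => rfl⟩
  have h1 : ‖D f‖ ≤ ‖(C : ℂ) • f‖ := lp.norm_mono (by norm_num) (hle f)
  rwa [norm_smul, Complex.norm_real] at h1

/-- The diagonal operator on a Hilbert sum given by a bounded family of operators. -/
noncomputable def hilbertSumOp (T : ∀ i, H i →L[ℂ] H i) (hT : ∃ C, ∀ i, ‖T i‖ ≤ C) :
    lp H 2 →L[ℂ] lp H 2 :=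
  (exists_hilbertSum_operator T hT.choose_spec).choose

theorem hilbertSumOp_apply (T : ∀ i, H i →L[ℂ] H i) (hT : ∃ C, ∀ i, ‖T i‖ ≤ C) (f : lp H 2)
    (i : ι) : hilbertSumOp T hT f i = T i (f i) :=
  (exists_hilbertSum_operator T hT.choose_spec).choose_spec f i

theorem hilbertSumOp_ext {D D' : lp H 2 →L[ℂ] lp H 2} (h : ∀ f i, D f i = D' f i) : D = D' :=
  ContinuousLinearMap.ext fun f => lp.ext (funext fun i => h f i)

theorem hilbertSumOp_single [DecidableEq ι] (T : ∀ i, H i →L[ℂ] H i) (hT : ∃ C, ∀ i, ‖T i‖ ≤ C)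
    (i : ι) (v : H i) : hilbertSumOp T hT (lp.single 2 i v) = lp.single 2 i (T i v) := by
  ext j
  rw [hilbertSumOp_apply]
  by_cases h : j = i
  · subst h; simp
  · rw [lp.single_apply_ne _ _ _ h, lp.single_apply_ne _ _ _ h, map_zero]

variable [∀ i, CompleteSpace (H i)]

theorem star_apply_of_diagonal {D : lp H 2 →L[ℂ] lp H 2} {T : ∀ i, H i →L[ℂ] H i}
    (h : ∀ f i, D f i = T i (f i)) (f : lp H 2) (i : ι) : (star D) f i = (star (T i)) (f i) := by
  classical
  refine ext_inner_left ℂ fun v => ?_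
  rw [← lp.inner_single_left, ContinuousLinearMap.star_eq_adjoint,
    ContinuousLinearMap.adjoint_inner_right, ContinuousLinearMap.star_eq_adjoint,
    ContinuousLinearMap.adjoint_inner_right, ← lp.inner_single_left]
  congr 1
  ext j
  rw [h]
  by_cases hj : j = i
  · subst hj; simp
  · rw [lp.single_apply_ne _ _ _ hj, lp.single_apply_ne _ _ _ hj, map_zero]

/-- A block of an operator that acts diagonally on a Hilbert sum has smaller norm. -/
theorem norm_le_of_diagonal {D : lp H 2 →L[ℂ] lp H 2} {i : ι} {T : H i →L[ℂ] H i}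
    (h : ∀ f, D f i = T (f i)) : ‖T‖ ≤ ‖D‖ := by
  classical
  refine T.opNorm_le_bound (norm_nonneg _) fun v => ?_
  have h1 := h (lp.single 2 i v)
  rw [lp.single_apply_self] at h1
  rw [← h1]
  refine (lp.norm_apply_le_norm (by norm_num) _ i).trans ((D.le_opNorm _).trans ?_)
  rw [lp.norm_single (by norm_num)]

variable {A : Type*} [NonUnitalCStarAlgebra A]

theorem bounded_family_of_reps (π : ∀ i, A →⋆ₙₐ[ℂ] (H i →L[ℂ] H i)) (a : A) :
    ∃ C, ∀ i, ‖π i a‖ ≤ C := ⟨‖a‖, fun i => NonUnitalStarAlgHom.norm_apply_le (π i) a⟩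

/-- The Hilbert sum of a family of representations. -/
noncomputable def hilbertSumRep (π : ∀ i, A →⋆ₙₐ[ℂ] (H i →L[ℂ] H i)) :
    A →⋆ₙₐ[ℂ] (lp H 2 →L[ℂ] lp H 2) where
  toFun a := hilbertSumOp (fun i => π i a) (bounded_family_of_reps π a)
  map_smul' c a := hilbertSumOp_ext fun f i => by
    rw [hilbertSumOp_apply, map_smul]
    change _ = c • (hilbertSumOp _ _ f i)
    rw [hilbertSumOp_apply]; rfl
  map_zero' := hilbertSumOp_ext fun f i => by
    rw [hilbertSumOp_apply, map_zero]; rfl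
  map_add' a b := hilbertSumOp_ext fun f i => by
    rw [hilbertSumOp_apply, map_add]
    change _ = hilbertSumOp _ _ f i + hilbertSumOp _ _ f i
    rw [hilbertSumOp_apply, hilbertSumOp_apply]; rfl
  map_mul' a b := hilbertSumOp_ext fun f i => by
    rw [hilbertSumOp_apply, map_mul, mul_apply_eq_comp, mul_apply_eq_comp,
      hilbertSumOp_apply, hilbertSumOp_apply]
  map_star' a := hilbertSumOp_ext fun f i => by
    rw [hilbertSumOp_apply, map_star, star_apply_of_diagonal (hilbertSumOp_apply _ _)]

theorem hilbertSumRep_apply (π : ∀ i, A →⋆ₙₐ[ℂ] (H i →L[ℂ] H i)) (a : A) (f : lp H 2) (i : ι) :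
    hilbertSumRep π a f i = π i a (f i) := hilbertSumOp_apply _ (bounded_family_of_reps π a) f i

/-- The closed span contains each summand by non-degeneracy of that block, and finite sums of such
vectors are dense. -/
theorem IsNondegenerateRep.hilbertSum {π : ∀ i, A →⋆ₙₐ[ℂ] (H i →L[ℂ] H i)}
    (hπ : ∀ i, IsNondegenerateRep (π i)) : IsNondegenerateRep (hilbertSumRep π) := by
  classical
  set N := Submodule.span ℂ {x : lp H 2 | ∃ (a : A) (h : lp H 2), hilbertSumRep π a h = x} with hN
  have h1 : ∀ i (v : H i), lp.single 2 i v ∈ N.topologicalClosure := by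
    intro i v
    have hcl : IsClosed ((N.topologicalClosure.comap
        (lp.singleContinuousLinearMap ℂ H 2 i).toLinearMap : Submodule ℂ (H i)) : Set (H i)) :=
      N.isClosed_topologicalClosure.preimage (lp.singleContinuousLinearMap ℂ H 2 i).continuous
    have hle : Submodule.span ℂ {x : H i | ∃ (a : A) (h : H i), π i a h = x} ≤
        N.topologicalClosure.comap (lp.singleContinuousLinearMap ℂ H 2 i).toLinearMap := by
      rw [Submodule.span_le]
      rintro _ ⟨a, h, rfl⟩
      refine N.le_topologicalClosure (Submodule.subset_span ⟨a, lp.single 2 i h, ?_⟩)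
      exact hilbertSumOp_single _ (bounded_family_of_reps π a) i h
    exact hcl.closure_subset_iff.2 hle (hπ i v)
  intro f
  change f ∈ N.topologicalClosure
  have hs := lp.hasSum_single (E := H) (p := 2) (by norm_num) f
  exact N.isClosed_topologicalClosure.mem_of_tendsto hs
    (Eventually.of_forall fun s => Submodule.sum_mem _ fun i _ => h1 i _)

end HilbertSum

/-! ### Faithful representations -/

section GelfandNaimark

open scoped ComplexOrder

variable {A : Type*} [NonUnitalCStarAlgebra A] [PartialOrder A] [StarOrderedRing A]

/-- Hahn–Banach separates -x*x from the closed convex cone of positive elements. -/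
theorem exists_real_functional {x : A} (hx : x ≠ 0) :
    ∃ f : A →L[ℝ] ℝ, (∀ a, 0 ≤ a → 0 ≤ f a) ∧ 0 < f (star x * x) := by
  have hconv : Convex ℝ {a : A | 0 ≤ a} := by
    intro a ha b hb s t hs ht _
    exact add_nonneg (smul_nonneg hs ha) (smul_nonneg ht hb)
  have hnot : -(star x * x) ∉ {a : A | 0 ≤ a} := by
    intro h
    have h' : 0 ≤ -(star x * x) := h
    rw [neg_nonneg] at h'
    exact hx ((CStarRing.star_mul_self_eq_zero_iff x).1
      (le_antisymm h' (star_mul_self_nonneg x)))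
  obtain ⟨f, u, hfu, hpos⟩ := geometric_hahn_banach_point_closed hconv
    CStarAlgebra.isClosed_nonneg hnot
  have hu : u < 0 := by simpa using hpos 0 (le_refl (0 : A))
  refine ⟨f, fun a ha => ?_, ?_⟩
  · by_contra! hneg
    -- A negative value on the cone could be scaled below the separating constant u.
    obtain ⟨n, hn⟩ := exists_nat_gt (u / f a)
    have h1 := hpos ((n : ℝ) • a) (smul_nonneg (Nat.cast_nonneg n) ha)
    rw [map_smul, smul_eq_mul] at h1
    rw [div_lt_iff_of_neg hneg] at hn
    linarith
  · rw [map_neg] at hfu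
    linarith

theorem exists_positive_functional {x : A} (hx : x ≠ 0) :
    ∃ g : A →ₚ[ℂ] ℂ, g (star x * x) ≠ 0 := by
  obtain ⟨f, hf, hfx⟩ := exists_real_functional hx
  -- Symmetrising under the adjoint makes the complexification real on self-adjoint elements, where
  -- it equals 2f.
  let f' : A →L[ℝ] ℝ := f + f.comp ((starL' ℝ : A ≃L[ℝ] A) : A →L[ℝ] A)
  have hf' : ∀ a, f' a = f a + f (star a) := fun a => rfl
  let g₀ : A →ₗ[ℂ] ℂ := (StrongDual.extendRCLike (𝕜 := ℂ) f').toLinearMap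
  have hg : ∀ a, star a = a → g₀ a = ((2 * f a : ℝ) : ℂ) := by
    intro a ha
    have h1 : f' a = 2 * f a := by rw [hf', ha]; ring
    have h2 : f' (Complex.I • a) = 0 := by
      rw [hf', star_smul, ha, Complex.star_def, Complex.conj_I, neg_smul, map_neg]; ring
    have h3 : g₀ a = ((f' a : ℝ) : ℂ) - Complex.I * ((f' (Complex.I • a) : ℝ) : ℂ) := rfl
    rw [h3, h1, h2]
    simp
  refine ⟨PositiveLinearMap.mk₀ g₀ fun a ha => ?_, ?_⟩
  · rw [hg a (IsSelfAdjoint.of_nonneg ha).star_eq]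
    exact_mod_cast mul_nonneg zero_le_two (hf a ha)
  · change g₀ (star x * x) ≠ 0
    rw [hg _ (by simp)]
    exact_mod_cast (mul_pos two_pos hfx).ne'

/-- Without a unit there is no vector that is cyclic by construction. The dense continuous copy of A
in the GNS space takes its place: vectors ι(u), for an approximate unit u, play the role of the
class of 1. Continuity is g(a*a) ≤ C‖a‖². -/
theorem exists_gns_embedding (g : A →ₚ[ℂ] ℂ) :
    ∃ ι : A →L[ℂ] g.GNS, DenseRange ι ∧ (∀ a b, g.gnsNonUnitalStarAlgHom a (ι b) = ι (a * b)) ∧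
      ∀ a, ι a = 0 → g (star a * a) = 0 := by
  obtain ⟨C, hC⟩ := g.exists_norm_apply_le
  have hsq : ∀ a : A, ‖g.toPreGNS a‖ ^ 2 ≤ (√C * ‖a‖) ^ 2 := by
    intro a
    have h1 : ((‖g.toPreGNS a‖ ^ 2 : ℝ) : ℂ) = g (star a * a) := by
      push_cast; exact g.preGNS_norm_sq (g.toPreGNS a)
    have h2 := hC (star a * a)
    rw [← h1, CStarRing.norm_star_mul_self, Complex.norm_real, Real.norm_of_nonneg (sq_nonneg _)]
      at h2
    rw [mul_pow, Real.sq_sqrt C.coe_nonneg]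
    linarith
  let j : A →L[ℂ] g.PreGNS := g.toPreGNS.toLinearMap.mkContinuous (√C) fun a =>
    le_of_sq_le_sq (hsq a) (by positivity)
  have hj : ∀ a, j a = g.toPreGNS a := fun a => rfl
  have hι : ∀ a, (UniformSpace.Completion.toComplL.comp j : A →L[ℂ] g.GNS) a =
      ((g.toPreGNS a : g.PreGNS) : g.GNS) := fun a => rfl
  refine ⟨UniformSpace.Completion.toComplL.comp j, ?_, fun a b => ?_, fun a ha => ?_⟩
  · have h := UniformSpace.Completion.denseRange_coe (α := g.PreGNS)
    refine Dense.mono ?_ h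
    rintro _ ⟨a, rfl⟩
    exact ⟨g.ofPreGNS a, hι _⟩
  · rw [hι, hι, PositiveLinearMap.gnsNonUnitalStarAlgHom_apply_coe]
    simp
  · rw [hι] at ha
    have h1 : ‖g.toPreGNS a‖ = 0 := by
      rw [← UniformSpace.Completion.norm_coe, ha, norm_zero]
    have h2 := g.preGNS_norm_sq (g.toPreGNS a)
    rw [h1] at h2
    simpa using h2.symm

theorem isNondegenerateRep_gns (g : A →ₚ[ℂ] ℂ) :
    IsNondegenerateRep g.gnsNonUnitalStarAlgHom := by
  obtain ⟨ι, hd, hmul, -⟩ := exists_gns_embedding g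
  have hmem : Set.range ι ⊆ closure (Submodule.span ℂ
      {x : g.GNS | ∃ (a : A) (h : g.GNS), g.gnsNonUnitalStarAlgHom a h = x} : Set g.GNS) := by
    rintro _ ⟨b, rfl⟩
    refine mem_closure_of_tendsto ((ι.continuous.tendsto b).comp
      ((CStarAlgebra.increasingApproximateUnit A).tendsto_mul_right b)) (Eventually.of_forall ?_)
    exact fun u => Submodule.subset_span ⟨u, ι b, hmul u b⟩
  exact dense_closure.1 (hd.mono hmem)

theorem gns_apply_ne_zero {g : A →ₚ[ℂ] ℂ} {x : A} (hx : g (star x * x) ≠ 0) :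
    g.gnsNonUnitalStarAlgHom x ≠ 0 := by
  obtain ⟨ι, -, hmul, h0⟩ := exists_gns_embedding g
  intro h
  refine hx (h0 x ?_)
  have ht := (ι.continuous.tendsto x).comp
    ((CStarAlgebra.increasingApproximateUnit A).tendsto_mul_left x)
  refine tendsto_nhds_unique ht (tendsto_const_nhds.congr fun u => ?_)
  rw [Function.comp_apply, ← hmul, h]
  rfl

end GelfandNaimark

/-- Every C⋆-algebra has a faithful non-degenerate representation. -/
theorem exists_faithful_rep.{w} (B : Type w) [NonUnitalCStarAlgebra B] :
    ∃ (H : Type w) (_ : NormedAddCommGroup H) (_ : InnerProductSpace ℂ H) (_ : CompleteSpace H)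
      (σ : B →⋆ₙₐ[ℂ] (H →L[ℂ] H)), IsNondegenerateRep σ ∧ Function.Injective σ := by
  let _ : PartialOrder B := CStarAlgebra.spectralOrder B
  have _ : StarOrderedRing B := CStarAlgebra.spectralOrderedRing B
  -- One GNS block for each nonzero x, chosen so that x acts nontrivially there.
  choose g hg using fun x : {x : B // x ≠ 0} => exists_positive_functional x.2
  refine ⟨lp (fun x => (g x).GNS) 2, inferInstance, inferInstance, inferInstance,
    hilbertSumRep fun x => (g x).gnsNonUnitalStarAlgHom,
    IsNondegenerateRep.hilbertSum fun x => isNondegenerateRep_gns (g x), ?_⟩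
  rw [injective_iff_map_eq_zero]
  intro x hx
  by_contra hne
  have h1 := norm_le_of_diagonal (D := hilbertSumRep (fun x => (g x).gnsNonUnitalStarAlgHom) x)
    (i := ⟨x, hne⟩) (fun f => hilbertSumRep_apply _ x f ⟨x, hne⟩)
  rw [hx, norm_zero] at h1
  exact gns_apply_ne_zero (hg ⟨x, hne⟩) (norm_le_zero_iff.1 h1)

/-! ### Covariant pairs -/

section CovariantPairs

variable {A : Type*} [NonUnitalCStarAlgebra A]
  {H : Type*} [NormedAddCommGroup H] [InnerProductSpace ℂ H] [CompleteSpace H]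

theorem IsStrictExtension.star_mul_map_apply {α : A →⋆ₙₐ[ℂ] A} {π : A →⋆ₙₐ[ℂ] (H →L[ℂ] H)}
    {V : H →L[ℂ] H} (hV : ∀ a, V * π a = π (α a) * V) (a : A) :
    star V * π (α a) = π a * star V := by
  have := congrArg star (hV (star a))
  rw [star_mul, star_mul, ← map_star, ← map_star, ← map_star, star_star] at this
  exact this.symm

variable [PartialOrder A]

namespace IsStrictExtension

variable {α : A →⋆ₙₐ[ℂ] A} {β : 𝓜(ℂ, A) →⋆ₙₐ[ℂ] 𝓜(ℂ, A)} {π : A →⋆ₙₐ[ℂ] (H →L[ℂ] H)}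
  {V : H →L[ℂ] H}

/-- The range projection of an intertwiner is dominated by `ᾱ(1)`. -/
theorem map_multRight_mul (h : IsStrictExtension α β) (hπ : IsNondegenerateRep π)
    (hV : ∀ a, V * π a = π (α a) * V) (a : A) : π (multRight a (β 1)) * V = π a * V := by
  obtain ⟨l, hl, hlim⟩ := h.2
  have := hl.neBot
  refine ContinuousLinearMap.ext fun k => ?_
  -- The vectors π(a)Vπ(u)k and π(aα(u))Vk agree. The first tends to π(a)Vk by non-degeneracy, the
  -- second to π(aᾱ(1))Vk by strictness.
  have h1 : Tendsto (fun u => (π a * V) (π u k)) l (𝓝 ((π a * V) k)) :=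
    ((π a * V).continuous.tendsto _).comp
      (hπ.tendsto_apply hl.toIsApproximateUnit hl.eventually_norm k)
  have h2 : Tendsto (fun u => π (a * α u) (V k)) l (𝓝 (π (multRight a (β 1)) (V k))) :=
    ((ContinuousLinearMap.apply ℂ H (V k)).continuous.tendsto _).comp
      (((NonUnitalStarAlgHom.continuous_of_cstar π).tendsto _).comp (hlim a).2)
  refine tendsto_nhds_unique h2 (h1.congr fun u => ?_)
  rw [map_mul, ← mul_apply_eq_comp, ← mul_apply_eq_comp, mul_assoc, hV, mul_assoc]

theorem star_mul_map_multLeft (h : IsStrictExtension α β) (hπ : IsNondegenerateRep π)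
    (hV : ∀ a, V * π a = π (α a) * V) (a : A) :
    star V * π (multLeft (β 1) a) = star V * π a := by
  have := congrArg star (h.map_multRight_mul hπ hV (star a))
  rw [star_mul, star_mul, ← map_star, ← map_star, star_star, star_multRight, star_star,
    star_map_one] at this
  exact this

/-- V*π(a) = V*π(ᾱ(1)a) is the norm limit of V*π(α(u)a) = π(u)V*π(a). This inserts a coefficient
π(u) next to V*, which makes products such as V_s V_t* π(a) and π(x) V V* π(y) tractable. -/
theorem exists_tendsto_map_mul (h : IsStrictExtension α β) (hπ : IsNondegenerateRep π)
    (hV : ∀ a, V * π a = π (α a) * V) (a : A) : ∃ l : Filter A, l.NeBot ∧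
      Tendsto (fun u => π u * (star V * π a)) l (𝓝 (star V * π a)) := by
  obtain ⟨l, hl, hlim⟩ := h.2
  refine ⟨l, hl.neBot, ?_⟩
  rw [← h.star_mul_map_multLeft hπ hV]
  refine ((((NonUnitalStarAlgHom.continuous_of_cstar π).tendsto _).comp (hlim a).1).const_mul
    (star V)).congr fun u => ?_
  rw [Function.comp_apply, map_mul, ← mul_assoc, star_mul_map_apply hV,
    h.star_mul_map_multLeft hπ hV, mul_assoc]

end IsStrictExtension

variable [StarOrderedRing A] {S : Type*} [AddCommMonoid S] {α : S → A →⋆ₙₐ[ℂ] A}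
  (hext : ∀ s, IsExtendible (α s)) {π : A →⋆ₙₐ[ℂ] (H →L[ℂ] H)} {V : S → (H →L[ℂ] H)}

/-- Toeplitz covariant pairs consist of isometries. -/
theorem IsToeplitzCovariant.isometry (hinj : ∀ s, Function.Injective (α s))
    (hher : ∀ s, HasHereditaryRange (α s))
    (h : IsToeplitzCovariant α (hereditaryTransfer α hext) H π V) (s : S) :
    star (V s) * V s = 1 := by
  obtain ⟨l, hl, hl1, -⟩ := exists_approximateUnit A
  have := hl.neBot
  refine h.nondegenerate.op_ext fun b k => ?_
  have h1 : Tendsto (fun u => (star (V s)) (π u (V s (π b k)))) l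
      (𝓝 ((star (V s)) (V s (π b k)))) :=
    ((star (V s)).continuous.tendsto _).comp (h.nondegenerate.tendsto_apply hl hl1 _)
  -- The operator V*π(u)V equals π(L_s(u)), and L_s(u)b = L_s(u α_s(b)) tends to L_s(α_s(b)) = b.
  have h2 : Tendsto (fun u => π (hereditaryTransfer α hext s u) (π b k)) l (𝓝 (π b k)) := by
    refine tendsto_map_mul_apply π (f := hereditaryTransfer α hext s) ?_ k
    simp only [← hereditaryTransfer_mul_right hext hinj hher]
    have := ((continuous_hereditaryTransfer hext hinj hher s).tendsto _).comp
      (hl.tendsto_mul_right (α s b))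
    rwa [hereditaryTransfer_apply hext hinj hher] at this
  refine tendsto_nhds_unique h1 (h2.congr fun u => ?_)
  rw [← h.tc2]
  rfl

/-- Pairs that are Toeplitz covariant, and covariant if `θ` holds. -/
structure IsRelCovariant (θ : Prop) (α : S → A →⋆ₙₐ[ℂ] A) (L : S → A → A) (H : Type*)
    [NormedAddCommGroup H] [InnerProductSpace ℂ H] [CompleteSpace H]
    (π : A →⋆ₙₐ[ℂ] (H →L[ℂ] H)) (V : S → (H →L[ℂ] H)) : Prop where
  toeplitz : IsToeplitzCovariant α L H π V
  isometry : ∀ s, star (V s) * V s = 1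
  covariance : θ → ∀ s a, V s * π a * star (V s) = π (α s a)

/-- V_s* π(a) V_s depends only on the corner ᾱ_s(1) a ᾱ_s(1) = α_s(L_s(a)), and V_s* π(α_s(c)) V_s =
π(c) for an isometry. -/
theorem IsIsometricCovariant.isToeplitzCovariant (hinj : ∀ s, Function.Injective (α s))
    (hher : ∀ s, HasHereditaryRange (α s)) (h : IsIsometricCovariant α H π V) :
    IsToeplitzCovariant α (hereditaryTransfer α hext) H π V := by
  have tc1 : ∀ s a, V s * π a = π (α s a) * V s := fun s a => by
    rw [← h.covariance, mul_assoc, h.isometry, mul_one]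
  refine ⟨h.nondegenerate, h.isRep, tc1, fun s a => ?_⟩
  have hs := (hext s).isStrictExtension
  calc star (V s) * π a * V s
      = star (V s) * π (multLeft ((hext s).extension 1) a) * V s := by
        rw [hs.star_mul_map_multLeft h.nondegenerate (tc1 s)]
    _ = star (V s) * π (α s (hereditaryTransfer α hext s a)) * V s := by
        rw [apply_hereditaryTransfer hext hinj hher, mul_assoc, mul_assoc,
          hs.map_multRight_mul h.nondegenerate (tc1 s)]
    _ = π (hereditaryTransfer α hext s a) := by
        rw [IsStrictExtension.star_mul_map_apply (tc1 s), mul_assoc, h.isometry, mul_one]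

/-- The two values of θ recover the two classes of pairs, so a single existence proof serves both
universal algebras. -/
theorem isRelCovariant_false_iff (hinj : ∀ s, Function.Injective (α s))
    (hher : ∀ s, HasHereditaryRange (α s)) :
    IsRelCovariant False α (hereditaryTransfer α hext) H π V ↔
      IsToeplitzCovariant α (hereditaryTransfer α hext) H π V :=
  ⟨fun h => h.toeplitz, fun h => ⟨h, h.isometry hext hinj hher, False.elim⟩⟩

theorem isRelCovariant_true_iff (hinj : ∀ s, Function.Injective (α s))
    (hher : ∀ s, HasHereditaryRange (α s)) :
    IsRelCovariant True α (hereditaryTransfer α hext) H π V ↔ IsIsometricCovariant α H π V :=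
  ⟨fun h => ⟨h.toeplitz.nondegenerate, h.toeplitz.isRep, h.isometry, h.covariance trivial⟩,
    fun h => ⟨h.isToeplitzCovariant hext hinj hher, h.isometry, fun _ => h.covariance⟩⟩

end CovariantPairs

/-! ### Hilbert sums of covariant pairs. -/

section HilbertSumPairs

variable {A S : Type*} [NonUnitalCStarAlgebra A] [AddCommMonoid S] {α : S → A →⋆ₙₐ[ℂ] A}
  {L : S → A → A} {θ : Prop}

theorem norm_le_one_of_isometry {H : Type*} [NormedAddCommGroup H] [InnerProductSpace ℂ H]
    [CompleteSpace H] {V : H →L[ℂ] H} (h : star V * V = 1) : ‖V‖ ≤ 1 := by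
  have h1 : ‖V‖ * ‖V‖ ≤ 1 := by
    rw [← CStarRing.norm_star_mul_self, h]
    exact ContinuousLinearMap.norm_id_le
  nlinarith [norm_nonneg V]

variable {ι : Type*} {H : ι → Type*} [∀ i, NormedAddCommGroup (H i)]
  [∀ i, InnerProductSpace ℂ (H i)] [∀ i, CompleteSpace (H i)]
  {π : ∀ i, A →⋆ₙₐ[ℂ] (H i →L[ℂ] H i)} {V : ∀ i, S → (H i →L[ℂ] H i)}

/-- Relative covariance passes to Hilbert sums. -/
theorem IsRelCovariant.hilbertSum (h : ∀ i, IsRelCovariant θ α L (H i) (π i) (V i))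
    {W : S → (lp H 2 →L[ℂ] lp H 2)} (hW : ∀ s f i, W s f i = V i s (f i)) :
    IsRelCovariant θ α L (lp H 2) (hilbertSumRep π) W := by
  have hWs : ∀ s f i, (star (W s)) f i = (star (V i s)) (f i) := fun s =>
    star_apply_of_diagonal (hW s)
  refine ⟨⟨IsNondegenerateRep.hilbertSum fun i => (h i).toeplitz.nondegenerate,
    ⟨?_, fun s t => ?_⟩, fun s a => ?_, fun s a => ?_⟩, fun s => ?_, fun hθ s a => ?_⟩ <;>
  refine hilbertSumOp_ext fun f i => ?_
  · rw [hW, (h i).toeplitz.isRep.map_zero]; rfl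
  · rw [hW, (h i).toeplitz.isRep.map_add, mul_apply_eq_comp, mul_apply_eq_comp, hW, hW]
  · rw [mul_apply_eq_comp, mul_apply_eq_comp, hW, hilbertSumRep_apply, hilbertSumRep_apply, hW,
      ← mul_apply_eq_comp, (h i).toeplitz.tc1]; rfl
  · rw [mul_apply_eq_comp, mul_apply_eq_comp, hWs, hilbertSumRep_apply, hilbertSumRep_apply, hW,
      ← (h i).toeplitz.tc2]; rfl
  · rw [mul_apply_eq_comp, hWs, hW, ← mul_apply_eq_comp, (h i).isometry]; rfl
  · rw [mul_apply_eq_comp, mul_apply_eq_comp, hW, hilbertSumRep_apply, hilbertSumRep_apply, hWs,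
      ← (h i).covariance hθ]; rfl

end HilbertSumPairs

/-! ### Multipliers of concrete C⋆-algebras -/

section Idealizer

variable {E : Type*} [NonUnitalCStarAlgebra E]

/-- A closed subspace that contains the generators and their adjoints and is stable under right
multiplication contains the generated C⋆-algebra. -/
theorem topologicalClosure_adjoin_subset {G : Set E} {N : Submodule ℂ E}
    (hN : IsClosed (N : Set E)) (hG : ∀ x ∈ G, x ∈ N ∧ star x ∈ N)
    (hmul : ∀ x ∈ N, ∀ y ∈ (NonUnitalStarAlgebra.adjoin ℂ G).topologicalClosure, x * y ∈ N) {x : E}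
    (hx : x ∈ (NonUnitalStarAlgebra.adjoin ℂ G).topologicalClosure) : x ∈ N := by
  refine closure_minimal (fun y hy => ?_) hN hx
  have hle := (NonUnitalStarAlgebra.adjoin ℂ G).le_topologicalClosure
  change y ∈ NonUnitalAlgebra.adjoin ℂ (G ∪ star G) at hy
  induction hy using NonUnitalAlgebra.adjoin_induction with
  | mem y hy =>
    rcases hy with hy | hy
    · exact (hG y hy).1
    · simpa using (hG (star y) hy).2
  | add y z _ _ h1 h2 => exact add_mem h1 h2
  | zero => exact zero_mem _
  | mul y z _ hz h1 _ => exact hmul y h1 z (hle hz)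
  | smul c y _ h => exact N.smul_mem c h

variable (B : NonUnitalStarSubalgebra ℂ E) [IsClosed (B : Set E)]

/-- An element of the ambient algebra that multiplies `B` into itself is a multiplier of `B`. -/
noncomputable def idealizerMultiplier (m : E) (hl : ∀ b ∈ B, m * b ∈ B) (hr : ∀ b ∈ B, b * m ∈ B) :
    𝓜(ℂ, B) where
  fst := LinearMap.mkContinuous
    { toFun := fun b => ⟨m * b, hl b b.2⟩
      map_add' := fun b c => Subtype.ext (mul_add m (b : E) c)
      map_smul' := fun c b => Subtype.ext (mul_smul_comm c m (b : E)) } ‖m‖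
    fun b => norm_mul_le m (b : E)
  snd := LinearMap.mkContinuous
    { toFun := fun b => ⟨b * m, hr b b.2⟩
      map_add' := fun b c => Subtype.ext (add_mul (b : E) c m)
      map_smul' := fun c b => Subtype.ext (smul_mul_assoc c (b : E) m) } ‖m‖
    fun b => (norm_mul_le (b : E) m).trans_eq (mul_comm _ _)
  central := fun x y => Subtype.ext (mul_assoc (x : E) m y)

variable {B} {m : E} {hl : ∀ b ∈ B, m * b ∈ B} {hr : ∀ b ∈ B, b * m ∈ B}

theorem coe_multLeft_idealizer (b : B) :
    ((multLeft (idealizerMultiplier B m hl hr) b : B) : E) = m * b := rfl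

theorem coe_multRight_idealizer (b : B) :
    ((multRight b (idealizerMultiplier B m hl hr) : B) : E) = b * m := rfl

theorem coe_multLeft_star_idealizer (b : B) :
    ((multLeft (star (idealizerMultiplier B m hl hr)) b : B) : E) = star m * b := by
  have := star_multRight (idealizerMultiplier B m hl hr) (star b)
  rw [star_star] at this
  rw [← this]
  change star (star (b : E) * m) = _
  rw [star_mul, star_star]

theorem coe_multRight_star_idealizer (b : B) :
    ((multRight b (star (idealizerMultiplier B m hl hr)) : B) : E) = b * star m := by
  have := star_multLeft (idealizerMultiplier B m hl hr) (star b)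
  rw [star_star] at this
  rw [← this]
  change star (m * star (b : E)) = _
  rw [star_mul, star_star]

end Idealizer

/-! ### Polynomials in the generators, and a pair that dominates all others -/

section Terms

/-- Formal ⋆-polynomials in the generators of the crossed products. -/
inductive StarTerm (A S : Type*) : Type _
  | alg (a : A) : StarTerm A S
  | isom (s : S) : StarTerm A S
  | zero : StarTerm A S
  | add (x y : StarTerm A S) : StarTerm A S
  | mul (x y : StarTerm A S) : StarTerm A S
  | smul (c : ℂ) (x : StarTerm A S) : StarTerm A S
  | star (x : StarTerm A S) : StarTerm A S

variable {A S : Type*} [NonUnitalCStarAlgebra A]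

/-- Evaluation of formal ⋆-polynomials at a pair `(π, V)`. -/
noncomputable def StarTerm.eval {H : Type*} [NormedAddCommGroup H] [InnerProductSpace ℂ H]
    [CompleteSpace H] (π : A →⋆ₙₐ[ℂ] (H →L[ℂ] H)) (V : S → (H →L[ℂ] H)) :
    StarTerm A S → (H →L[ℂ] H)
  | .alg a => π a
  | .isom s => V s
  | .zero => 0
  | .add x y => x.eval π V + y.eval π V
  | .mul x y => x.eval π V * y.eval π V
  | .smul c x => c • x.eval π V
  | .star x => Star.star (x.eval π V)

theorem StarTerm.eval_hilbertSum {ι : Type*} {H : ι → Type*} [∀ i, NormedAddCommGroup (H i)]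
    [∀ i, InnerProductSpace ℂ (H i)] [∀ i, CompleteSpace (H i)]
    {π : ∀ i, A →⋆ₙₐ[ℂ] (H i →L[ℂ] H i)} {V : ∀ i, S → (H i →L[ℂ] H i)}
    {W : S → (lp H 2 →L[ℂ] lp H 2)} (hW : ∀ s f i, W s f i = V i s (f i)) (t : StarTerm A S) :
    ∀ f i, t.eval (hilbertSumRep π) W f i = t.eval (π i) (V i) (f i) := by
  induction t with
  | alg a => exact hilbertSumRep_apply π a
  | isom s => exact hW s
  | zero => intro f i; rfl
  | add x y hx hy =>
    intro f i
    simp only [StarTerm.eval, add_apply, ← hx, ← hy]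
    rfl
  | mul x y hx hy =>
    intro f i
    simp only [StarTerm.eval, mul_apply_eq_comp, ← hy, ← hx]
  | smul c x hx =>
    intro f i
    simp only [StarTerm.eval, smul_apply, ← hx]
    rfl
  | star x hx => exact star_apply_of_diagonal hx

variable {A : Type u} {S : Type v} [NonUnitalCStarAlgebra A] [AddCommMonoid S]

/-- A relatively covariant pair on some Hilbert space. -/
structure RelCovariantPair (θ : Prop) (α : S → A →⋆ₙₐ[ℂ] A) (L : S → A → A) where
  H : Type (max u v)
  [normed : NormedAddCommGroup H]
  [inner : InnerProductSpace ℂ H]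
  [complete : CompleteSpace H]
  π : A →⋆ₙₐ[ℂ] (H →L[ℂ] H)
  V : S → (H →L[ℂ] H)
  covariant : IsRelCovariant θ α L H π V

attribute [instance] RelCovariantPair.normed RelCovariantPair.inner RelCovariantPair.complete

/-- There is a relatively covariant pair that dominates all others in norm. -/
theorem exists_dominating_pair (θ : Prop) (α : S → A →⋆ₙₐ[ℂ] A) (L : S → A → A) :
    ∃ ρ : RelCovariantPair.{u, v} θ α L, ∀ (ρ' : RelCovariantPair.{u, v} θ α L)
      (t : StarTerm A S), ‖t.eval ρ'.π ρ'.V‖ ≤ ‖t.eval ρ.π ρ.V‖ := by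
  -- All pairs together are too many to sum. One witness for each polynomial and each rational
  -- strictly below some attained norm suffices, and these indices form a type in the right
  -- universe.
  let ι : Type (max u v) := {p : StarTerm A S × ℚ //
    ∃ ρ : RelCovariantPair.{u, v} θ α L, (p.2 : ℝ) < ‖p.1.eval ρ.π ρ.V‖}
  choose ρ hρ using fun i : ι => i.2
  let W : S → (lp (fun i => (ρ i).H) 2 →L[ℂ] lp (fun i => (ρ i).H) 2) := fun s =>
    hilbertSumOp (fun i => (ρ i).V s)
      ⟨1, fun i => norm_le_one_of_isometry ((ρ i).covariant.isometry s)⟩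
  have hW : ∀ s f i, W s f i = (ρ i).V s (f i) := fun s => hilbertSumOp_apply _ _
  refine ⟨⟨lp (fun i => (ρ i).H) 2, hilbertSumRep fun i => (ρ i).π, W,
    IsRelCovariant.hilbertSum (fun i => (ρ i).covariant) hW⟩, fun ρ' t => ?_⟩
  by_contra! hlt
  -- The block indexed by (t, q) has norm above q, yet the norm of the sum would be below q.
  obtain ⟨q, hq1, hq2⟩ := exists_rat_btwn hlt
  have h1 := hρ ⟨(t, q), ρ', hq2⟩
  have h2 := norm_le_of_diagonal (fun f => StarTerm.eval_hilbertSum (π := fun i => (ρ i).π) hW t f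
    ⟨(t, q), ρ', hq2⟩)
  exact absurd (h1.trans_le h2) (not_lt.2 hq1.le)

end Terms

/-! ### The algebra generated by a pair -/

section GeneratedAlgebra

variable {A S K : Type*} [NonUnitalCStarAlgebra A]
  [NormedAddCommGroup K] [InnerProductSpace ℂ K] [CompleteSpace K]

/-- The C⋆-algebra generated by the operators `π(a) V_s`. -/
noncomputable def pairAlgebra (π : A →⋆ₙₐ[ℂ] (K →L[ℂ] K)) (V : S → (K →L[ℂ] K)) :
    NonUnitalStarSubalgebra ℂ (K →L[ℂ] K) :=
  (NonUnitalStarAlgebra.adjoin ℂ {x | ∃ a s, π a * V s = x}).topologicalClosure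

instance isClosed_pairAlgebra (π : A →⋆ₙₐ[ℂ] (K →L[ℂ] K)) (V : S → (K →L[ℂ] K)) :
    IsClosed (pairAlgebra π V : Set (K →L[ℂ] K)) :=
  NonUnitalStarSubalgebra.isClosed_topologicalClosure _

variable {π : A →⋆ₙₐ[ℂ] (K →L[ℂ] K)} {V : S → (K →L[ℂ] K)}

theorem mul_mem_pairAlgebra (a : A) (s : S) : π a * V s ∈ pairAlgebra π V :=
  NonUnitalStarSubalgebra.le_topologicalClosure _
    (NonUnitalStarAlgebra.subset_adjoin ℂ _ ⟨a, s, rfl⟩)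

theorem star_mul_mem_pairAlgebra (a : A) (s : S) : star (V s) * π a ∈ pairAlgebra π V := by
  have := star_mem (mul_mem_pairAlgebra (π := π) (V := V) (star a) s)
  rwa [star_mul, ← map_star, star_star] at this

variable [AddCommMonoid S] {α : S → A →⋆ₙₐ[ℂ] A} {L : S → A → A}

namespace IsToeplitzCovariant

theorem map_mem_pairAlgebra (h : IsToeplitzCovariant α L K π V) (a : A) : π a ∈ pairAlgebra π V := by
  have := mul_mem_pairAlgebra (π := π) (V := V) a 0
  rwa [h.isRep.map_zero, mul_one] at this

theorem star_map_add (h : IsToeplitzCovariant α L K π V) (s t : S) :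
    star (V s) * star (V t) = star (V (s + t)) := by
  rw [add_comm, h.isRep.map_add, star_mul]

/-- The delicate generators are the adjoints: V_s V_t* π(a) is the limit of V_s π(u) V_t* π(a) =
(π(α_s(u))V_s)(V_t* π(a)), a product of two elements of the algebra. -/
theorem mul_mem_of_mem [PartialOrder A] (hext : ∀ s, IsExtendible (α s))
    (h : IsToeplitzCovariant α L K π V) (s : S) {b : K →L[ℂ] K} (hb : b ∈ pairAlgebra π V) : V s * b ∈ pairAlgebra π V := by
  let N : Submodule ℂ (K →L[ℂ] K) :=
    (pairAlgebra π V).toSubmodule.comap (LinearMap.mulLeft ℂ (V s))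
  have hN : IsClosed (N : Set (K →L[ℂ] K)) :=
    (isClosed_pairAlgebra π V).preimage (continuous_const_mul (V s))
  refine topologicalClosure_adjoin_subset (N := N) hN ?_ ?_ hb
  · rintro _ ⟨a, t, rfl⟩
    constructor
    · change V s * (π a * V t) ∈ pairAlgebra π V
      rw [← mul_assoc, h.tc1, mul_assoc, ← h.isRep.map_add]
      exact mul_mem_pairAlgebra _ _
    · change V s * star (π a * V t) ∈ pairAlgebra π V
      rw [star_mul, ← map_star]
      obtain ⟨l, hl, hlim⟩ := (hext t).isStrictExtension.exists_tendsto_map_mul h.nondegenerate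
        (h.tc1 t) (star a)
      refine (isClosed_pairAlgebra π V).mem_of_tendsto (hlim.const_mul (V s))
        (Eventually.of_forall fun u => ?_)
      rw [← mul_assoc, h.tc1]
      exact mul_mem (mul_mem_pairAlgebra _ _) (star_mul_mem_pairAlgebra _ _)
  · intro x hx y hy
    change V s * (x * y) ∈ pairAlgebra π V
    rw [← mul_assoc]
    exact mul_mem hx hy

/-- V_s* π(a) V_t is the limit of (V_s* π(a))(π(u) V_t). For the adjoints, commutativity of S gives
V_s* V_t* = V_{s+t}*. -/
theorem star_mul_mem_of_mem (h : IsToeplitzCovariant α L K π V)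
    (s : S) {b : K →L[ℂ] K} (hb : b ∈ pairAlgebra π V) : star (V s) * b ∈ pairAlgebra π V := by
  let N : Submodule ℂ (K →L[ℂ] K) :=
    (pairAlgebra π V).toSubmodule.comap (LinearMap.mulLeft ℂ (star (V s)))
  have hN : IsClosed (N : Set (K →L[ℂ] K)) :=
    (isClosed_pairAlgebra π V).preimage (continuous_const_mul (star (V s)))
  refine topologicalClosure_adjoin_subset (N := N) hN ?_ ?_ hb
  · rintro _ ⟨a, t, rfl⟩
    constructor
    · change star (V s) * (π a * V t) ∈ pairAlgebra π V
      obtain ⟨l, hl, -, -⟩ := exists_approximateUnit A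
      have := hl.neBot
      have hlim := ((((NonUnitalStarAlgHom.continuous_of_cstar π).tendsto _).comp
        (hl.tendsto_mul_left a)).mul_const (V t)).const_mul (star (V s))
      refine (isClosed_pairAlgebra π V).mem_of_tendsto hlim (Eventually.of_forall fun u => ?_)
      rw [Function.comp_apply, map_mul, mul_assoc, ← mul_assoc (star (V s))]
      exact mul_mem (star_mul_mem_pairAlgebra _ _) (mul_mem_pairAlgebra _ _)
    · change star (V s) * star (π a * V t) ∈ pairAlgebra π V
      rw [star_mul, ← map_star, ← mul_assoc, h.star_map_add]
      exact star_mul_mem_pairAlgebra _ _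
  · intro x hx y hy
    change star (V s) * (x * y) ∈ pairAlgebra π V
    rw [← mul_assoc]
    exact mul_mem hx hy

theorem mem_mul_of_mem (h : IsToeplitzCovariant α L K π V)
    (s : S) {b : K →L[ℂ] K} (hb : b ∈ pairAlgebra π V) : b * V s ∈ pairAlgebra π V := by
  have := star_mem (h.star_mul_mem_of_mem s (star_mem hb))
  rwa [star_mul, star_star, star_star] at this

/-- The inclusion of the coefficient algebra into the algebra generated by a pair. -/
noncomputable def toPairAlgebra (h : IsToeplitzCovariant α L K π V) : A →⋆ₙₐ[ℂ] pairAlgebra π V :=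
  NonUnitalStarAlgHom.codRestrict π (pairAlgebra π V) h.map_mem_pairAlgebra

theorem coe_toPairAlgebra (h : IsToeplitzCovariant α L K π V) (a : A) :
    ((h.toPairAlgebra a : pairAlgebra π V) : K →L[ℂ] K) = π a := rfl

/-- The isometries of a pair as multipliers of the algebra that the pair generates. -/
noncomputable def pairMultiplier [PartialOrder A] (hext : ∀ s, IsExtendible (α s))
    (h : IsToeplitzCovariant α L K π V) (s : S) : 𝓜(ℂ, pairAlgebra π V) :=
  idealizerMultiplier (pairAlgebra π V) (V s) (fun _ hb => h.mul_mem_of_mem hext s hb)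
    (fun _ hb => h.mem_mul_of_mem s hb)

theorem isNondegenerateHom_toPairAlgebra [PartialOrder A] (hext : ∀ s, IsExtendible (α s))
    (h : IsToeplitzCovariant α L K π V) : IsNondegenerateHom h.toPairAlgebra := by
  let M : Submodule ℂ (K →L[ℂ] K) := (Submodule.span ℂ
    {x : pairAlgebra π V | ∃ (a : A) (b : pairAlgebra π V), h.toPairAlgebra a * b = x}).map
      ((pairAlgebra π V).toSubmodule.subtype)
  have hMmem : ∀ (a : A), ∀ b ∈ pairAlgebra π V, π a * b ∈ M := fun a b hb =>
    ⟨h.toPairAlgebra a * ⟨b, hb⟩, Submodule.subset_span ⟨a, ⟨b, hb⟩, rfl⟩, rfl⟩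
  have hMmul : ∀ x ∈ M, ∀ y ∈ pairAlgebra π V, x * y ∈ M := by
    rintro _ ⟨x, hx, rfl⟩ y hy
    induction hx using Submodule.span_induction with
    | mem x hx =>
      obtain ⟨a, b, rfl⟩ := hx
      have := hMmem a (b * y) (mul_mem b.2 hy)
      rw [← mul_assoc] at this
      exact this
    | zero => rw [map_zero, zero_mul]; exact zero_mem _
    | add x z _ _ h1 h2 => rw [map_add, add_mul]; exact add_mem h1 h2
    | smul c x _ h1 => rw [map_smul, smul_mul_assoc]; exact M.smul_mem c h1
  rw [IsNondegenerateHom, Subtype.dense_iff]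
  intro x hx
  change x ∈ M.topologicalClosure
  refine topologicalClosure_adjoin_subset M.isClosed_topologicalClosure ?_ ?_ hx
  · rintro _ ⟨a, t, rfl⟩
    constructor
    · obtain ⟨l, hl, -, -⟩ := exists_approximateUnit A
      have := hl.neBot
      have hlim := (((NonUnitalStarAlgHom.continuous_of_cstar π).tendsto _).comp
        (hl.tendsto_mul_right a)).mul_const (V t)
      refine mem_closure_of_tendsto hlim (Eventually.of_forall fun u => ?_)
      rw [Function.comp_apply, map_mul, mul_assoc]
      exact hMmem u _ (mul_mem_pairAlgebra a t)
    · rw [star_mul, ← map_star]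
      obtain ⟨l, hl, hlim⟩ := (hext t).isStrictExtension.exists_tendsto_map_mul h.nondegenerate
        (h.tc1 t) (star a)
      exact mem_closure_of_tendsto hlim
        (Eventually.of_forall fun u => hMmem u _ (star_mul_mem_pairAlgebra _ _))
  · intro x hx y hy
    exact map_mem_closure (f := fun z => z * y) (continuous_mul_const y) hx
      fun z hz => hMmul z hz y hy

theorem generated_pairAlgebra [PartialOrder A] (hext : ∀ s, IsExtendible (α s))
    (h : IsToeplitzCovariant α L K π V) : Dense (NonUnitalStarAlgebra.adjoin ℂ
      {x : pairAlgebra π V | ∃ (a : A) (s : S),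
        multRight (h.toPairAlgebra a) (h.pairMultiplier hext s) = x} : Set (pairAlgebra π V)) := by
  rw [Subtype.dense_iff]
  intro x hx
  refine closure_mono ?_ hx
  let i := NonUnitalStarSubalgebraClass.subtype (pairAlgebra π V)
  have := NonUnitalStarAlgHom.map_adjoin (R := ℂ) i {x : pairAlgebra π V | ∃ (a : A) (s : S),
        multRight (h.toPairAlgebra a) (h.pairMultiplier hext s) = x}
  intro y hy
  have hy' : y ∈ NonUnitalStarAlgebra.adjoin ℂ (i '' {x : pairAlgebra π V | ∃ (a : A) (s : S),
        multRight (h.toPairAlgebra a) (h.pairMultiplier hext s) = x}) := by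
    refine NonUnitalStarAlgebra.adjoin_mono ?_ hy
    rintro _ ⟨a, s, rfl⟩
    exact ⟨_, ⟨a, s, rfl⟩, rfl⟩
  rw [← this] at hy'
  exact hy'

end IsToeplitzCovariant

end GeneratedAlgebra

/-! ### Existence of the universal algebras -/

section Existence

/-- A star subalgebra of a product that is the graph of a function is the graph of a
homomorphism. -/
theorem exists_hom_of_graph {E F : Type*} [NonUnitalCStarAlgebra E] [NonUnitalCStarAlgebra F]
    {B : NonUnitalStarSubalgebra ℂ E} {Γ : NonUnitalStarSubalgebra ℂ (E × F)}
    (huniq : ∀ x y z, (x, y) ∈ Γ → (x, z) ∈ Γ → y = z) (hex : ∀ x ∈ B, ∃ y, (x, y) ∈ Γ) :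
    ∃ σ : B →⋆ₙₐ[ℂ] F, ∀ b : B, ((b : E), σ b) ∈ Γ := by
  choose f hf using fun x : B => hex x x.2
  refine ⟨{ toFun := f, map_smul' := fun c x => ?_, map_zero' := ?_, map_add' := fun x y => ?_,
            map_mul' := fun x y => ?_, map_star' := fun x => ?_ }, hf⟩
  · exact huniq _ _ _ (hf _) (Γ.smul_mem c (hf x))
  · exact huniq _ _ _ (hf _) (zero_mem Γ)
  · exact huniq _ _ _ (hf _) (add_mem (hf x) (hf y))
  · exact huniq _ _ _ (hf _) (mul_mem (hf x) (hf y))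
  · exact huniq _ _ _ (hf _) (star_mem (hf x))

/-- The first projection of a closed graph is closed. -/
theorem le_fst_of_graph {E F : Type*} [NonUnitalCStarAlgebra E] [NonUnitalCStarAlgebra F]
    {G : Set E} {Γ : NonUnitalStarSubalgebra ℂ (E × F)} (hclosed : IsClosed (Γ : Set (E × F)))
    (huniq : ∀ x y z, (x, y) ∈ Γ → (x, z) ∈ Γ → y = z) (hG : ∀ x ∈ G, ∃ y, (x, y) ∈ Γ) :
    ∀ x ∈ (NonUnitalStarAlgebra.adjoin ℂ G).topologicalClosure, ∃ y, (x, y) ∈ Γ := by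
  let f : Γ →⋆ₙₐ[ℂ] E :=
    (NonUnitalStarAlgHom.fst ℂ E F).comp (NonUnitalStarSubalgebraClass.subtype Γ)
  have hf : ∀ x : Γ, f x = x.1.1 := fun x => rfl
  -- An injective homomorphism of C⋆-algebras has closed range, so the projection of Γ already
  -- contains the closure of the generated algebra.
  have hinj : Function.Injective f := by
    intro x y hxy
    refine Subtype.ext (Prod.ext hxy (huniq x.1.1 _ _ x.2 ?_))
    rw [← hf, hxy]
    exact y.2
  have hr := NonUnitalStarAlgHom.isClosed_range_of_injective f hinj
  have hle : (NonUnitalStarAlgebra.adjoin ℂ G).topologicalClosure ≤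
      NonUnitalStarAlgHom.range f := by
    refine NonUnitalStarSubalgebra.topologicalClosure_minimal _ ?_ hr
    refine NonUnitalStarAlgebra.adjoin_le fun x hx => ?_
    obtain ⟨y, hy⟩ := hG x hx
    exact ⟨⟨(x, y), hy⟩, rfl⟩
  intro x hx
  obtain ⟨y, hy⟩ := hle hx
  exact ⟨y.1.2, by rw [← hy]; exact y.2⟩

/-- The elements (π(a), π'(a)) and (V_s, V'_s) generate a C⋆-algebra Γ in the product. Domination on
polynomials extends to ‖y‖ ≤ ‖x‖ on Γ by continuity, so Γ is the graph of a function. The last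
clause is phrased with b and c because V_s itself need not lie in the domain of σ. -/
theorem exists_hom_of_dominated {A S K H : Type*} [NonUnitalCStarAlgebra A] [AddCommMonoid S]
    [NormedAddCommGroup K] [InnerProductSpace ℂ K] [CompleteSpace K]
    [NormedAddCommGroup H] [InnerProductSpace ℂ H] [CompleteSpace H]
    {π : A →⋆ₙₐ[ℂ] (K →L[ℂ] K)} {V : S → (K →L[ℂ] K)}
    {π' : A →⋆ₙₐ[ℂ] (H →L[ℂ] H)} {V' : S → (H →L[ℂ] H)}
    (hdom : ∀ t : StarTerm A S, ‖t.eval π' V'‖ ≤ ‖t.eval π V‖) :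
    ∃ σ : pairAlgebra π V →⋆ₙₐ[ℂ] (H →L[ℂ] H),
      (∀ a (b : pairAlgebra π V), (b : K →L[ℂ] K) = π a → σ b = π' a) ∧
      ∀ s (b c : pairAlgebra π V), (c : K →L[ℂ] K) = V s * b → σ c = V' s * σ b := by
  let G : Set ((K →L[ℂ] K) × (H →L[ℂ] H)) :=
    {x | (∃ a, (π a, π' a) = x) ∨ ∃ s, (V s, V' s) = x}
  let Γ := (NonUnitalStarAlgebra.adjoin ℂ G).topologicalClosure
  have hG : ∀ x ∈ G, x ∈ Γ := fun x hx =>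
    NonUnitalStarSubalgebra.le_topologicalClosure _ (NonUnitalStarAlgebra.subset_adjoin ℂ _ hx)
  have hclosed : IsClosed (Γ : Set ((K →L[ℂ] K) × (H →L[ℂ] H))) :=
    NonUnitalStarSubalgebra.isClosed_topologicalClosure _
  have hterm : ∀ x ∈ NonUnitalStarAlgebra.adjoin ℂ G,
      ∃ t : StarTerm A S, (t.eval π V, t.eval π' V') = x := by
    intro x hx
    induction hx using NonUnitalStarAlgebra.adjoin_induction with
    | mem x hx =>
      rcases hx with ⟨a, rfl⟩ | ⟨s, rfl⟩
      · exact ⟨.alg a, rfl⟩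
      · exact ⟨.isom s, rfl⟩
    | add x y _ _ hx hy =>
      obtain ⟨t, rfl⟩ := hx
      obtain ⟨t', rfl⟩ := hy
      exact ⟨.add t t', rfl⟩
    | zero => exact ⟨.zero, rfl⟩
    | mul x y _ _ hx hy =>
      obtain ⟨t, rfl⟩ := hx
      obtain ⟨t', rfl⟩ := hy
      exact ⟨.mul t t', rfl⟩
    | smul c x _ hx =>
      obtain ⟨t, rfl⟩ := hx
      exact ⟨.smul c t, rfl⟩
    | star x _ hx =>
      obtain ⟨t, rfl⟩ := hx
      exact ⟨.star t, rfl⟩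
  have hnorm : ∀ x ∈ Γ, ‖x.2‖ ≤ ‖x.1‖ := by
    intro x hx
    refine closure_minimal (t := {x : (K →L[ℂ] K) × (H →L[ℂ] H) | ‖x.2‖ ≤ ‖x.1‖}) ?_
      (isClosed_le (by fun_prop) (by fun_prop)) hx
    intro y hy
    obtain ⟨t, rfl⟩ := hterm y hy
    exact hdom t
  have huniq : ∀ x y z, (x, y) ∈ Γ → (x, z) ∈ Γ → y = z := by
    intro x y z hy hz
    have := hnorm _ (sub_mem hy hz)
    simp only [Prod.mk_sub_mk, sub_self, norm_zero, norm_le_zero_iff] at this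
    exact sub_eq_zero.1 this
  have hex : ∀ x ∈ pairAlgebra π V, ∃ y, (x, y) ∈ Γ := by
    refine le_fst_of_graph hclosed huniq ?_
    rintro _ ⟨a, s, rfl⟩
    exact ⟨π' a * V' s, mul_mem (hG _ (Or.inl ⟨a, rfl⟩)) (hG _ (Or.inr ⟨s, rfl⟩))⟩
  obtain ⟨σ, hσ⟩ := exists_hom_of_graph huniq hex
  refine ⟨σ, fun a b hb => ?_, fun s b c hc => ?_⟩
  · exact huniq _ _ _ (hσ b) (by rw [hb]; exact hG _ (Or.inl ⟨a, rfl⟩))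
  · refine huniq _ _ _ (hσ c) ?_
    rw [hc]
    exact mul_mem (hG _ (Or.inr ⟨s, rfl⟩)) (hσ b)

theorem IsNondegenerateRep.of_comp {A B H : Type*} [NonUnitalCStarAlgebra A]
    [NonUnitalCStarAlgebra B] [NormedAddCommGroup H] [InnerProductSpace ℂ H] [CompleteSpace H]
    {σ : B →⋆ₙₐ[ℂ] (H →L[ℂ] H)} {i : A →⋆ₙₐ[ℂ] B} (h : IsNondegenerateRep (σ.comp i)) :
    IsNondegenerateRep σ := by
  refine Dense.mono ?_ h
  refine Submodule.span_mono ?_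
  rintro _ ⟨a, k, rfl⟩
  exact ⟨i a, k, rfl⟩

theorem IsNondegenerateRep.comp {A B H : Type*} [NonUnitalCStarAlgebra A]
    [NonUnitalCStarAlgebra B] [NormedAddCommGroup H] [InnerProductSpace ℂ H] [CompleteSpace H]
    {σ : B →⋆ₙₐ[ℂ] (H →L[ℂ] H)} {i : A →⋆ₙₐ[ℂ] B} (h : IsNondegenerateRep σ)
    (hi : IsNondegenerateHom i) : IsNondegenerateRep (σ.comp i) := by
  set N := Submodule.span ℂ {x : H | ∃ (a : A) (k : H), (σ.comp i) a k = x}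
  have hN : IsClosed (N.topologicalClosure : Set H) := N.isClosed_topologicalClosure
  have h1 : ∀ b k, σ b k ∈ N.topologicalClosure := by
    intro b k
    let P : Submodule ℂ B := N.topologicalClosure.comap
      ((ContinuousLinearMap.apply ℂ H k).toLinearMap ∘ₗ (σ : B →ₗ[ℂ] (H →L[ℂ] H)))
    have hP : IsClosed (P : Set B) := hN.preimage
      ((ContinuousLinearMap.apply ℂ H k).continuous.comp
        (NonUnitalStarAlgHom.continuous_of_cstar σ))
    have hle : Submodule.span ℂ {x : B | ∃ (a : A) (b : B), i a * b = x} ≤ P := by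
      rw [Submodule.span_le]
      rintro _ ⟨a, c, rfl⟩
      refine N.le_topologicalClosure (Submodule.subset_span ⟨a, σ c k, ?_⟩)
      change σ (i a) (σ c k) = σ (i a * c) k
      rw [map_mul]; rfl
    exact hP.closure_subset_iff.2 hle (hi b)
  intro x
  have hle : Submodule.span ℂ {x : H | ∃ (b : B) (k : H), σ b k = x} ≤ N.topologicalClosure := by
    rw [Submodule.span_le]
    rintro _ ⟨b, k, rfl⟩
    exact h1 b k
  exact hN.closure_subset_iff.2 hle (h x)

/-- Relations between multipliers give covariance of the represented pair. -/
theorem isRelCovariant_of_relations {A S B H : Type*} [NonUnitalCStarAlgebra A] [AddCommMonoid S]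
    [NonUnitalCStarAlgebra B] [NormedAddCommGroup H] [InnerProductSpace ℂ H] [CompleteSpace H]
    {θ : Prop} {α : S → A →⋆ₙₐ[ℂ] A} {L : S → A → A} {iA : A →⋆ₙₐ[ℂ] B} {iS : S → 𝓜(ℂ, B)}
    (hi : IsNondegenerateHom iA) (hrep : IsSemigroupRep iS)
    (tc1 : ∀ s a, multLeft (iS s) (iA a) = multRight (iA (α s a)) (iS s))
    (tc2 : ∀ s a, multRight (multLeft (star (iS s)) (iA a)) (iS s) = iA (L s a))
    (hiso : ∀ s, star (iS s) * iS s = 1)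
    (hcov : θ → ∀ s a, multRight (multLeft (iS s) (iA a)) (star (iS s)) = iA (α s a))
    {σ : B →⋆ₙₐ[ℂ] (H →L[ℂ] H)} (hσ : IsNondegenerateRep σ)
    {σbar : 𝓜(ℂ, B) →⋆ₐ[ℂ] (H →L[ℂ] H)} (hbar : IsMultiplierExtension σ σbar) :
    IsRelCovariant θ α L H (σ.comp iA) (fun s => σbar (iS s)) := by
  refine ⟨⟨hσ.comp hi, ⟨?_, fun s t => ?_⟩, fun s a => ?_, fun s a => ?_⟩, fun s => ?_,
    fun hθ s a => ?_⟩
  · rw [hrep.map_zero, map_one]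
  · rw [hrep.map_add, map_mul]
  · rw [NonUnitalStarAlgHom.comp_apply, NonUnitalStarAlgHom.comp_apply, hbar.mul_map, hbar.map_mul,
      tc1]
  · rw [NonUnitalStarAlgHom.comp_apply, NonUnitalStarAlgHom.comp_apply, ← map_star, hbar.mul_map,
      hbar.map_mul, tc2]
  · rw [← map_star, ← map_mul, hiso, map_one]
  · rw [NonUnitalStarAlgHom.comp_apply, NonUnitalStarAlgHom.comp_apply, ← map_star, hbar.mul_map,
      hbar.map_mul, hcov hθ]

theorem exists_multiplierExtension_of_mul {S B H : Type*} [NonUnitalCStarAlgebra B]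
    [NormedAddCommGroup H] [InnerProductSpace ℂ H] [CompleteSpace H] {iS : S → 𝓜(ℂ, B)}
    {σ : B →⋆ₙₐ[ℂ] (H →L[ℂ] H)} {V : S → (H →L[ℂ] H)} (hσ : IsNondegenerateRep σ)
    (hV : ∀ s b, σ (multLeft (iS s) b) = V s * σ b) :
    ∃ σbar : 𝓜(ℂ, B) →⋆ₐ[ℂ] (H →L[ℂ] H), IsMultiplierExtension σ σbar ∧
      ∀ s, σbar (iS s) = V s := by
  obtain ⟨σbar, hbar⟩ := hσ.exists_multiplierExtension
  refine ⟨σbar, hbar, fun s => hσ.op_ext fun b k => ?_⟩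
  rw [← mul_apply_eq_comp, hbar.mul_map, hV]
  rfl

variable {A : Type u} {S : Type v} [NonUnitalCStarAlgebra A] [PartialOrder A] [AddCommMonoid S]
  {α : S → A →⋆ₙₐ[ℂ] A} {L : S → A → A}

set_option maxHeartbeats 800000 in
/-- The universal algebra for relatively covariant pairs exists. -/
theorem exists_universalAlgebra (θ : Prop) (hext : ∀ s, IsExtendible (α s)) :
    ∃ (B : Type (max u v)) (_ : NonUnitalCStarAlgebra B) (iA : A →⋆ₙₐ[ℂ] B) (iS : S → 𝓜(ℂ, B)),
      IsUniversalAlgebra.{max u v} (fun H _ _ _ π V => IsRelCovariant θ α L H π V) iA iS := by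
  obtain ⟨ρ, hρ⟩ := exists_dominating_pair θ α L
  have hT := ρ.covariant.toeplitz
  have hl : ∀ s (b : pairAlgebra ρ.π ρ.V),
      ((multLeft (hT.pairMultiplier hext s) b : pairAlgebra ρ.π ρ.V) : ρ.H →L[ℂ] ρ.H) =
        ρ.V s * b := fun s b => coe_multLeft_idealizer b
  have hr : ∀ s (b : pairAlgebra ρ.π ρ.V),
      ((multRight b (hT.pairMultiplier hext s) : pairAlgebra ρ.π ρ.V) : ρ.H →L[ℂ] ρ.H) =
        b * ρ.V s := fun s b => coe_multRight_idealizer b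
  have hls : ∀ s (b : pairAlgebra ρ.π ρ.V),
      ((multLeft (star (hT.pairMultiplier hext s)) b : pairAlgebra ρ.π ρ.V) : ρ.H →L[ℂ] ρ.H) =
        star (ρ.V s) * b := fun s b => coe_multLeft_star_idealizer b
  have hrs : ∀ s (b : pairAlgebra ρ.π ρ.V),
      ((multRight b (star (hT.pairMultiplier hext s)) : pairAlgebra ρ.π ρ.V) : ρ.H →L[ℂ] ρ.H) =
        b * star (ρ.V s) := fun s b => coe_multRight_star_idealizer b
  have hrep : IsSemigroupRep (hT.pairMultiplier hext) := by
    refine ⟨multiplier_ext fun x => Subtype.ext ?_, fun s t => multiplier_ext fun x =>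
      Subtype.ext ?_⟩
    · rw [hl, hT.isRep.map_zero, one_mul, multLeft_one]
    · rw [hl, hT.isRep.map_add, multLeft_mul_mult, hl, hl, mul_assoc]
  have htc1 : ∀ s a, multLeft (hT.pairMultiplier hext s) (hT.toPairAlgebra a) =
      multRight (hT.toPairAlgebra (α s a)) (hT.pairMultiplier hext s) := fun s a =>
    Subtype.ext (by rw [hl, hr, hT.coe_toPairAlgebra, hT.coe_toPairAlgebra, hT.tc1])
  have htc2 : ∀ s a, multRight (multLeft (star (hT.pairMultiplier hext s)) (hT.toPairAlgebra a))
      (hT.pairMultiplier hext s) = hT.toPairAlgebra (L s a) := fun s a =>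
    Subtype.ext (by rw [hr, hls, hT.coe_toPairAlgebra, hT.coe_toPairAlgebra, hT.tc2])
  have hiso : ∀ s, star (hT.pairMultiplier hext s) * hT.pairMultiplier hext s = 1 := fun s =>
    multiplier_ext fun x => Subtype.ext (by
      rw [multLeft_mul_mult, hls, hl, ← mul_assoc, ρ.covariant.isometry, one_mul, multLeft_one])
  have hcov : θ → ∀ s a, multRight (multLeft (hT.pairMultiplier hext s) (hT.toPairAlgebra a))
      (star (hT.pairMultiplier hext s)) = hT.toPairAlgebra (α s a) := fun hθ s a =>
    Subtype.ext (by
      rw [hrs, hl, hT.coe_toPairAlgebra, hT.coe_toPairAlgebra, ρ.covariant.covariance hθ])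
  refine ⟨pairAlgebra ρ.π ρ.V, inferInstance, hT.toPairAlgebra, hT.pairMultiplier hext,
    hT.isNondegenerateHom_toPairAlgebra hext, hrep, ?_, ?_, hT.generated_pairAlgebra hext⟩
  · intro H _ _ _ σ hσ
    obtain ⟨σbar, hbar⟩ := hσ.exists_multiplierExtension
    exact ⟨σbar, hbar, isRelCovariant_of_relations (hT.isNondegenerateHom_toPairAlgebra hext)
      hrep htc1 htc2 hiso hcov hσ hbar⟩
  · intro H _ _ _ π V hV
    obtain ⟨σ, hσ1, hσ2⟩ := exists_hom_of_dominated (hρ ⟨H, π, V, hV⟩)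
    have hcomp : σ.comp hT.toPairAlgebra = π := by
      ext1 a
      exact hσ1 a _ rfl
    have hnd : IsNondegenerateRep (σ.comp hT.toPairAlgebra) := by
      rw [hcomp]
      exact hV.toeplitz.nondegenerate
    obtain ⟨σbar, hbar, hbarS⟩ := exists_multiplierExtension_of_mul (iS := hT.pairMultiplier hext)
      hnd.of_comp fun s b => hσ2 s b _ (hl s b)
    exact ⟨σ, σbar, hbar, hcomp, hbarS⟩

theorem IsUniversalAlgebra.congr.{w, z} {A : Type u} {S : Type v} {B : Type z}
    [NonUnitalCStarAlgebra A] [AddCommMonoid S] [NonUnitalCStarAlgebra B]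
    {Cov Cov' : ∀ (H : Type w) [NormedAddCommGroup H] [InnerProductSpace ℂ H] [CompleteSpace H],
      (A →⋆ₙₐ[ℂ] (H →L[ℂ] H)) → (S → (H →L[ℂ] H)) → Prop}
    (hCov : ∀ (H : Type w) [NormedAddCommGroup H] [InnerProductSpace ℂ H] [CompleteSpace H]
      (π : A →⋆ₙₐ[ℂ] (H →L[ℂ] H)) (V : S → (H →L[ℂ] H)), Cov H π V ↔ Cov' H π V)
    {iA : A →⋆ₙₐ[ℂ] B} {iS : S → 𝓜(ℂ, B)} (h : IsUniversalAlgebra.{w} Cov iA iS) :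
    IsUniversalAlgebra.{w} Cov' iA iS where
  nondegenerate := h.nondegenerate
  isRep := h.isRep
  covariant H _ _ _ σ hσ := by
    obtain ⟨σbar, h1, h2⟩ := h.covariant H σ hσ
    exact ⟨σbar, h1, (hCov H _ _).1 h2⟩
  universal H _ _ _ π V hV := h.universal H π V ((hCov H _ _).2 hV)
  generated := h.generated

end Existence

/-! ### Homomorphisms on quotients and generated algebras -/

section Homs

theorem ClosedIdeal.span_le {B : Type*} [NonUnitalCStarAlgebra B] {E : Set B} {J : ClosedIdeal B}
    (h : E ⊆ J.toSubmodule) : (ClosedIdeal.span E).toSubmodule ≤ J.toSubmodule :=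
  sInf_le ⟨J, rfl, h⟩

theorem ClosedIdeal.subset_span {B : Type*} [NonUnitalCStarAlgebra B] {E : Set B} {x : B}
    (hx : x ∈ E) : x ∈ (ClosedIdeal.span E).toSubmodule := by
  refine (Submodule.mem_sInf).2 ?_
  rintro J ⟨I, rfl, hE⟩
  exact hE hx

/-- The kernel of a homomorphism of C⋆-algebras. -/
def ClosedIdeal.ker {B D : Type*} [NonUnitalCStarAlgebra B] [NonUnitalCStarAlgebra D]
    (φ : B →⋆ₙₐ[ℂ] D) : ClosedIdeal B where
  toSubmodule := LinearMap.ker (φ : B →ₗ[ℂ] D)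
  isClosed' := isClosed_singleton.preimage (NonUnitalStarAlgHom.continuous_of_cstar φ)
  mul_mem_left' b x hx := by
    change φ (b * x) = 0
    rw [map_mul, show φ x = 0 from hx, mul_zero]
  mul_mem_right' {x} b hx := by
    change φ (x * b) = 0
    rw [map_mul, show φ x = 0 from hx, zero_mul]

/-- Homomorphisms that vanish on a closed ideal factor through the quotient. -/
theorem ClosedIdeal.exists_lift {B D : Type*} [NonUnitalCStarAlgebra B] [NonUnitalCStarAlgebra D]
    (I : ClosedIdeal B) (φ : B →⋆ₙₐ[ℂ] D) (h : ∀ x ∈ I.toSubmodule, φ x = 0) :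
    ∃ ψ : I.Quotient →⋆ₙₐ[ℂ] D, ∀ b, ψ (ClosedIdeal.Quotient.mk I b) = φ b := by
  let f : I.Quotient →ₗ[ℂ] D := I.toSubmodule.liftQ (φ : B →ₗ[ℂ] D) h
  have hf : ∀ b, f (ClosedIdeal.Quotient.mkₗ I b) = φ b := fun b => rfl
  refine ⟨{ toFun := f, map_smul' := map_smul f, map_zero' := map_zero f, map_add' := map_add f,
            map_mul' := fun x y => ?_, map_star' := fun x => ?_ }, fun b => rfl⟩
  · induction x using ClosedIdeal.Quotient.ind
    induction y using ClosedIdeal.Quotient.ind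
    rw [← ClosedIdeal.Quotient.mkₗ_mul, hf, hf, hf, map_mul]
  · induction x using ClosedIdeal.Quotient.ind
    rw [← ClosedIdeal.Quotient.mkₗ_star, hf, hf, map_star]

theorem ClosedIdeal.Quotient.mk_surjective {B : Type*} [NonUnitalCStarAlgebra B]
    (I : ClosedIdeal B) : Function.Surjective (ClosedIdeal.Quotient.mk I) :=
  ClosedIdeal.Quotient.mkₗ_surjective I

variable {B D : Type*} [NonUnitalCStarAlgebra B] [NonUnitalCStarAlgebra D] {G : Set B}

theorem mem_of_generated (hG : Dense (NonUnitalStarAlgebra.adjoin ℂ G : Set B))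
    {T : NonUnitalStarSubalgebra ℂ B} (hT : IsClosed (T : Set B)) (h : G ⊆ T) (b : B) : b ∈ T :=
  hT.closure_subset_iff.2 (NonUnitalStarAlgebra.adjoin_le h) (hG b)

theorem hom_ext_of_generated (hG : Dense (NonUnitalStarAlgebra.adjoin ℂ G : Set B))
    {φ ψ : B →⋆ₙₐ[ℂ] D} (h : ∀ x ∈ G, φ x = ψ x) (b : B) : φ b = ψ b :=
  mem_of_generated hG (T := NonUnitalStarAlgHom.equalizer φ ψ)
    (isClosed_eq (NonUnitalStarAlgHom.continuous_of_cstar φ)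
      (NonUnitalStarAlgHom.continuous_of_cstar ψ)) h b

/-- A homomorphism with values in the range of an injective one factors through it. -/
theorem exists_factor_of_injective {E : Type*} [NonUnitalCStarAlgebra E]
    (hG : Dense (NonUnitalStarAlgebra.adjoin ℂ G : Set B)) {ρ : B →⋆ₙₐ[ℂ] E} {σ : D →⋆ₙₐ[ℂ] E}
    (hσ : Function.Injective σ) (h : ∀ x ∈ G, ρ x ∈ Set.range σ) :
    ∃ ψ : B →⋆ₙₐ[ℂ] D, ∀ b, σ (ψ b) = ρ b := by
  have hcl := NonUnitalStarAlgHom.isClosed_range_of_injective σ hσ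
  have hmem : ∀ b, ρ b ∈ Set.range σ := mem_of_generated hG
    (T := (NonUnitalStarAlgHom.range σ).comap ρ)
    (hcl.preimage (NonUnitalStarAlgHom.continuous_of_cstar ρ)) h
  choose f hf using hmem
  refine ⟨{ toFun := f, map_smul' := fun c x => hσ ?_, map_zero' := hσ ?_,
            map_add' := fun x y => hσ ?_, map_mul' := fun x y => hσ ?_,
            map_star' := fun x => hσ ?_ }, hf⟩
  · rw [hf, MonoidHom.id_apply, map_smul, map_smul, hf]
  · rw [hf, map_zero, map_zero]
  · rw [hf, map_add, map_add, hf, hf]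
  · rw [hf, map_mul, map_mul, hf, hf]
  · rw [hf, map_star, map_star, hf]

end Homs

/-! ### Redundancies -/

section Redundancy

variable {A S B H : Type*} [NonUnitalCStarAlgebra A] [PartialOrder A] [AddCommMonoid S]
  [NonUnitalCStarAlgebra B] [NormedAddCommGroup H] [InnerProductSpace ℂ H] [CompleteSpace H]
  {α : S → A →⋆ₙₐ[ℂ] A} {iA : A →⋆ₙₐ[ℂ] B} {iS : S → 𝓜(ℂ, B)}

/-- Covariant representations identify the components of a redundancy. -/
theorem map_eq_of_isRedundancy (hext : ∀ s, IsExtendible (α s)) {ρ : B →⋆ₙₐ[ℂ] (H →L[ℂ] H)}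
    {ρbar : 𝓜(ℂ, B) →⋆ₐ[ℂ] (H →L[ℂ] H)} (hbar : IsMultiplierExtension ρ ρbar)
    (hcov : IsIsometricCovariant α H (ρ.comp iA) (fun s => ρbar (iS s))) {s : S} {a k : B}
    (hred : IsRedundancy iA iS s a k) (ha : a ∈ rangeIdealImage α iA s) : ρ a = ρ k := by
  have hρ := NonUnitalStarAlgHom.continuous_of_cstar ρ
  set V := ρbar (iS s) with hVdef
  have hc : ∀ x, V * ρ (iA x) * star V = ρ (iA (α s x)) := hcov.covariance s
  have hiso : star V * V = 1 := hcov.isometry s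
  have tc1 : ∀ x, V * ρ (iA x) = ρ (iA (α s x)) * V := fun x => by
    rw [← hc, mul_assoc, hiso, mul_one]
  set z := ρ a - ρ k with hz
  have hz0 : ∀ b, z * (ρ (iA b) * V) = 0 := fun b => by
    rw [hVdef, hbar.map_mul, hz, sub_mul, ← map_mul, ← map_mul, hred.eq, sub_self]
  -- J is to contain both ρ(a) and ρ(k), while z annihilates the adjoints of its elements.
  let J : Submodule ℂ (H →L[ℂ] H) :=
    (Submodule.span ℂ {x | ∃ a b c : A, ρ (iA (a * α s b * c)) = x}).topologicalClosure
  have hJ : IsClosed (J : Set (H →L[ℂ] H)) := Submodule.isClosed_topologicalClosure _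
  have hJgen : ∀ a b c : A, ρ (iA (a * α s b * c)) ∈ J := fun a b c =>
    Submodule.le_topologicalClosure _ (Submodule.subset_span ⟨a, b, c, rfl⟩)
  have hmem : ∀ (M : Set B), (∀ x ∈ M, ρ x ∈ J) → ∀ x ∈ closure (Submodule.span ℂ M : Set B),
      ρ x ∈ J := by
    intro M hM x hx
    have hle : Submodule.span ℂ M ≤ J.comap (ρ : B →ₗ[ℂ] (H →L[ℂ] H)) := Submodule.span_le.2 hM
    exact (hJ.preimage hρ).closure_subset_iff.2 hle hx
  have haJ : ρ a ∈ J := by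
    refine hmem _ ?_ a ha
    rintro _ ⟨x, y, w, rfl⟩
    exact hJgen x y w
  have hkJ : ρ k ∈ J := by
    refine hmem _ ?_ k hred.right_mem
    rintro _ ⟨x, y, rfl⟩
    have e : ρ (multRight (iA x) (iS s * star (iS s)) * iA y) =
        ρ (iA x) * V * (star V * ρ (iA y)) := by
      rw [map_mul, ← hbar.map_mul, map_mul, map_star]
      simp only [mul_assoc, hVdef]
    rw [e]
    -- Inserting π(u) between V and V* turns π(x)VV*π(y) into a limit of π(x α_s(u) y).
    obtain ⟨l, hl, hlim⟩ := (hext s).isStrictExtension.exists_tendsto_map_mul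
      (π := ρ.comp iA) (V := V) hcov.nondegenerate tc1 y
    refine hJ.mem_of_tendsto (hlim.const_mul (ρ (iA x) * V)) (Eventually.of_forall fun u => ?_)
    have e2 : ρ (iA x) * V * ((ρ.comp iA) u * (star V * (ρ.comp iA) y)) =
        ρ (iA (x * α s u * y)) := by
      rw [NonUnitalStarAlgHom.comp_apply, NonUnitalStarAlgHom.comp_apply, map_mul, map_mul, map_mul,
        map_mul, ← hc]
      simp only [mul_assoc]
    rw [e2]
    exact hJgen x u y
  let N : Submodule ℂ (H →L[ℂ] H) :=
    { carrier := {y | z * star y = 0}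
      add_mem' := fun {x y} hx hy => by
        change z * star (x + y) = 0
        rw [star_add, mul_add, show z * star x = 0 from hx, show z * star y = 0 from hy, add_zero]
      zero_mem' := by
        change z * star 0 = 0
        rw [star_zero, mul_zero]
      smul_mem' := fun c x hx => by
        change z * star (c • x) = 0
        rw [star_smul, mul_smul_comm, show z * star x = 0 from hx, smul_zero] }
  have hN : IsClosed (N : Set (H →L[ℂ] H)) :=
    isClosed_eq (continuous_const.mul continuous_star) continuous_const
  have hJN : J ≤ N := by
    refine Submodule.topologicalClosure_minimal _ (Submodule.span_le.2 ?_) hN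
    rintro _ ⟨x, y, w, rfl⟩
    change z * star (ρ (iA (x * α s y * w))) = 0
    rw [← map_star, ← map_star, star_mul, star_mul, ← map_star, map_mul, map_mul, map_mul, map_mul,
      ← hc]
    -- By covariance the adjoint begins with π(w*)V, which z annihilates.
    have : z * (ρ (iA (star w)) * (V * ρ (iA (star y)) * star V * ρ (iA (star x)))) =
        z * (ρ (iA (star w)) * V) * (ρ (iA (star y)) * star V * ρ (iA (star x))) := by
      simp only [mul_assoc]
    rw [this, hz0, zero_mul]
  have hzz : z * star z = 0 := hJN (J.sub_mem haJ hkJ)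
  exact sub_eq_zero.1 ((CStarRing.mul_star_self_eq_zero_iff z).1 hzz)

end Redundancy

/-! ### The crossed product by transfer operators and the semigroup crossed product -/

section Comparison

theorem map_mem_rangeIdealImage {A S B : Type*} [NonUnitalCStarAlgebra A]
    [NonUnitalCStarAlgebra B] {α : S → A →⋆ₙₐ[ℂ] A} (iA : A →⋆ₙₐ[ℂ] B) (s : S) (b : A) :
    iA (α s b) ∈ rangeIdealImage α iA s := by
  obtain ⟨l, hl, -, -⟩ := exists_approximateUnit A
  have := hl.neBot
  have hi := NonUnitalStarAlgHom.continuous_of_cstar iA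
  have h1 : ∀ w, iA (α s b * w) ∈ rangeIdealImage α iA s := fun w => by
    refine mem_closure_of_tendsto ((hi.tendsto _).comp (hl.tendsto_mul_right (α s b * w)))
      (Eventually.of_forall fun u => Submodule.subset_span ⟨u, b, w, ?_⟩)
    rw [Function.comp_apply, mul_assoc]
  exact isClosed_closure.mem_of_tendsto ((hi.tendsto _).comp (hl.tendsto_mul_left (α s b)))
    (Eventually.of_forall h1)

variable {A : Type u} {S : Type v} [NonUnitalCStarAlgebra A] [PartialOrder A]
  [AddCommMonoid S] {α : S → A →⋆ₙₐ[ℂ] A} {B : Type (max u v)} [NonUnitalCStarAlgebra B]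
  {iA : A →⋆ₙₐ[ℂ] B} {iS : S → 𝓜(ℂ, B)}

namespace IsToeplitzCrossedProduct

/-- The covariance relations in the multiplier algebra of the Toeplitz crossed product. -/
theorem relations (hext : ∀ s, IsExtendible (α s)) {L : S → A → A}
    (hB : IsToeplitzCrossedProduct.{max u v} α L iA iS) (s : S) (a : A) :
    iS s * (iA a : 𝓜(ℂ, B)) = (iA (α s a) : 𝓜(ℂ, B)) * iS s ∧
    star (iS s) * (iA a : 𝓜(ℂ, B)) * iS s = ((iA (L s a) : B) : 𝓜(ℂ, B)) ∧
    ((iA (multRight a ((hext s).extension 1)) : B) : 𝓜(ℂ, B)) * iS s =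
      (iA a : 𝓜(ℂ, B)) * iS s := by
  -- The relations are known only in representations; a faithful one pulls them back to M(B). Its
  -- Hilbert space lies in the universe over which the universal property quantifies.
  obtain ⟨H, _, _, _, σ, hσ, hinj⟩ := exists_faithful_rep B
  obtain ⟨σbar, hbar, hT⟩ := hB.covariant H σ hσ
  have t1 : σbar (iS s) * σ (iA a) = σ (iA (α s a)) * σbar (iS s) := hT.tc1 s a
  have t2 : star (σbar (iS s)) * σ (iA a) * σbar (iS s) = σ (iA (L s a)) := hT.tc2 s a
  have t3 : σ (iA (multRight a ((hext s).extension 1))) * σbar (iS s) =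
      σ (iA a) * σbar (iS s) :=
    (hext s).isStrictExtension.map_multRight_mul (π := σ.comp iA) hT.nondegenerate (hT.tc1 s) a
  refine ⟨?_, ?_, ?_⟩
  · rw [hbar.mul_map, hbar.map_mul] at t1
    rw [← coe_multLeft, ← coe_multRight, hinj t1]
  · rw [← map_star, hbar.mul_map, hbar.map_mul] at t2
    rw [← coe_multLeft, ← coe_multRight, hinj t2]
  · rw [hbar.map_mul, hbar.map_mul] at t3
    rw [← coe_multRight, ← coe_multRight, hinj t3]

variable [StarOrderedRing A]

/-- The canonical redundancies. -/
theorem isRedundancy (hext : ∀ s, IsExtendible (α s)) (hinj : ∀ s, Function.Injective (α s))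
    (hher : ∀ s, HasHereditaryRange (α s))
    (hB : IsToeplitzCrossedProduct.{max u v} α (hereditaryTransfer α hext) iA iS) (s : S) (b : A) :
    IsRedundancy iA iS s (iA (α s b)) (multRight (multLeft (iS s) (iA b)) (star (iS s))) := by
  have R1 := fun a => (hB.relations hext s a).1
  have R1' : ∀ a, (iA a : 𝓜(ℂ, B)) * star (iS s) = star (iS s) * (iA (α s a) : 𝓜(ℂ, B)) := by
    intro a
    have := congrArg star (R1 (star a))
    rw [star_mul, star_mul, ← multiplierCoe_star, ← multiplierCoe_star, ← map_star, ← map_star,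
      ← map_star, star_star] at this
    exact this
  have R2 := fun a => (hB.relations hext s a).2.1
  have R3 := fun a => (hB.relations hext s a).2.2
  refine ⟨⟨_, rfl⟩, ?_, fun c => multiplierCoe_injective ?_⟩
  · obtain ⟨l, hl, -, -⟩ := exists_approximateUnit A
    have := hl.neBot
    -- With V = i_S(s), V b V* is the limit of V b u V* = α_s(b) V V* α_s(u), which has the required
    -- form.
    have hlim := ((continuous_multRight (star (iS s))).comp (continuous_multLeft (iS s))).tendsto _
      |>.comp (((NonUnitalStarAlgHom.continuous_of_cstar iA).tendsto _).comp
        (hl.tendsto_mul_left b))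
    refine mem_closure_of_tendsto hlim (Eventually.of_forall fun u => ?_)
    refine Submodule.subset_span ⟨α s b, α s u, multiplierCoe_injective ?_⟩
    simp only [Function.comp_apply, multiplierCoe_mul, coe_multRight, coe_multLeft, map_mul]
    rw [mul_assoc (iS s), mul_assoc ((iA b : B) : 𝓜(ℂ, B)), R1', ← mul_assoc (iS s), R1]
    simp only [mul_assoc]
  · simp only [multiplierCoe_mul, coe_multRight, coe_multLeft]
    -- With V = i_S(s) and p = ᾱ_s(1): V b (V* c V) = V b L_s(c) = α_s(b) p c p V = α_s(b) c V.
    have e1 : iS s * (iA b : 𝓜(ℂ, B)) * star (iS s) * ((iA c : 𝓜(ℂ, B)) * iS s) =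
        iS s * (iA b : 𝓜(ℂ, B)) * (star (iS s) * (iA c : 𝓜(ℂ, B)) * iS s) := by
      simp only [mul_assoc]
    rw [e1, R2, mul_assoc, ← multiplierCoe_mul, ← map_mul, R1, map_mul,
      apply_hereditaryTransfer hext hinj hher, ← mul_multRight, ← multRight_mul_eq,
      (hext s).isStrictExtension.multRight_apply, R3, map_mul, multiplierCoe_mul, mul_assoc]

/-- Representations of the quotient by the redundancies are covariant. -/
theorem isIsometricCovariant (hext : ∀ s, IsExtendible (α s))
    (hinj : ∀ s, Function.Injective (α s)) (hher : ∀ s, HasHereditaryRange (α s))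
    (hB : IsToeplitzCrossedProduct.{max u v} α (hereditaryTransfer α hext) iA iS)
    {H : Type (max u v)} [NormedAddCommGroup H] [InnerProductSpace ℂ H] [CompleteSpace H]
    {ρ : B →⋆ₙₐ[ℂ] (H →L[ℂ] H)} {ρbar : 𝓜(ℂ, B) →⋆ₐ[ℂ] (H →L[ℂ] H)}
    (hbar : IsMultiplierExtension ρ ρbar)
    (hT : IsToeplitzCovariant α (hereditaryTransfer α hext) H (ρ.comp iA) fun s => ρbar (iS s))
    (hker : ∀ x ∈ (redundancyIdeal α iA iS).toSubmodule, ρ x = 0) :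
    IsIsometricCovariant α H (ρ.comp iA) fun s => ρbar (iS s) := by
  refine ⟨hT.nondegenerate, hT.isRep, hT.isometry hext hinj hher, fun s b => ?_⟩
  have h := hker _ (ClosedIdeal.subset_span ⟨s, _, _, hB.isRedundancy hext hinj hher s b,
    map_mem_rangeIdealImage iA s b, rfl⟩)
  rw [map_sub, sub_eq_zero] at h
  rw [NonUnitalStarAlgHom.comp_apply, NonUnitalStarAlgHom.comp_apply, h, ← map_star, hbar.mul_map,
    hbar.map_mul]

end IsToeplitzCrossedProduct

variable [StarOrderedRing A]

/-- The crossed product by transfer operators is the semigroup crossed product. -/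
theorem exists_starAlgEquiv_crossedProduct (hext : ∀ s, IsExtendible (α s))
    (hinj : ∀ s, Function.Injective (α s)) (hher : ∀ s, HasHereditaryRange (α s))
    {C : Type (max u v)} [NonUnitalCStarAlgebra C] {jA : A →⋆ₙₐ[ℂ] C} {jS : S → 𝓜(ℂ, C)}
    (hB : IsToeplitzCrossedProduct.{max u v} α (hereditaryTransfer α hext) iA iS)
    (hC : IsSemigroupCrossedProduct.{max u v} α jA jS) :
    ∃ Φ : TransferCrossedProduct α iA iS ≃⋆ₐ[ℂ] C,
      (∀ a, Φ (ClosedIdeal.Quotient.mk _ (iA a)) = jA a) ∧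
      ∀ a s, Φ (ClosedIdeal.Quotient.mk _ (multRight (iA a) (iS s))) =
        multRight (jA a) (jS s) := by
  obtain ⟨H, _, _, _, σ, hσ, hσinj⟩ := exists_faithful_rep C
  obtain ⟨σbar, hσbar, hcov⟩ := hC.covariant H σ hσ
  obtain ⟨ρ, ρbar, hρbar, hρA, hρS⟩ := hB.universal H _ _
    (hcov.isToeplitzCovariant hext hinj hher)
  have hρA' : ∀ a, ρ (iA a) = σ (jA a) := fun a => congrArg (fun φ => φ a) hρA
  have hρgen : ∀ a s, ρ (multRight (iA a) (iS s)) = σ (multRight (jA a) (jS s)) := fun a s => by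
    rw [← hρbar.map_mul, ← hσbar.map_mul, hρA', hρS]
  -- The representation ρ sends generators into σ(C), so it descends to a homomorphism into C
  -- itself.
  obtain ⟨ψ, hψ⟩ := exists_factor_of_injective hB.generated (ρ := ρ) hσinj
    (by rintro _ ⟨a, s, rfl⟩; exact ⟨_, (hρgen a s).symm⟩)
  have hψA : ∀ a, ψ (iA a) = jA a := fun a => hσinj (by rw [hψ, hρA'])
  have hψgen : ∀ a s, ψ (multRight (iA a) (iS s)) = multRight (jA a) (jS s) := fun a s =>
    hσinj (by rw [hψ, hρgen])
  have hψker : ∀ x ∈ (redundancyIdeal α iA iS).toSubmodule, ψ x = 0 := by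
    refine ClosedIdeal.span_le (J := ClosedIdeal.ker ψ) ?_
    rintro _ ⟨s, a, k, hred, ha, rfl⟩
    change ψ (a - k) = 0
    refine hσinj ?_
    have hcov' : IsIsometricCovariant α H (ρ.comp iA) fun s => ρbar (iS s) := by
      rw [hρA, funext hρS]
      exact hcov
    rw [hψ, map_sub, map_eq_of_isRedundancy hext hρbar hcov' hred ha, sub_self, map_zero]
  obtain ⟨Ψ, hΨ⟩ := ClosedIdeal.exists_lift _ ψ hψker
  have hΨinj : Function.Injective Ψ := by
    -- A faithful representation τ of the quotient gives a covariant pair, hence a representation μ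
    -- of C with μ ∘ ψ = τ ∘ q. Thus ψ identifies no more than q does.
    obtain ⟨H', _, _, _, τ, hτ, hτinj⟩ := exists_faithful_rep (TransferCrossedProduct α iA iS)
    set q := ClosedIdeal.Quotient.mk (redundancyIdeal α iA iS)
    have hτq : IsNondegenerateRep (τ.comp q) := by
      refine Dense.mono (Submodule.span_mono ?_) hτ
      rintro _ ⟨x, k, rfl⟩
      obtain ⟨b, rfl⟩ := ClosedIdeal.Quotient.mk_surjective _ x
      exact ⟨b, k, rfl⟩
    obtain ⟨τbar, hτbar, hT⟩ := hB.covariant H' (τ.comp q) hτq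
    have hker : ∀ x ∈ (redundancyIdeal α iA iS).toSubmodule, (τ.comp q) x = 0 := by
      intro x hx
      have : q x = q 0 := (ClosedIdeal.Quotient.mkₗ_eq_iff _).2 (by rwa [sub_zero])
      rw [NonUnitalStarAlgHom.comp_apply, this, map_zero, map_zero]
    obtain ⟨μ, μbar, hμbar, hμA, hμS⟩ := hC.universal H' _ _
      (hB.isIsometricCovariant hext hinj hher hτbar hT hker)
    have hμA' : ∀ a, μ (jA a) = (τ.comp q) (iA a) := fun a => congrArg (fun φ => φ a) hμA
    have key : ∀ b, (μ.comp ψ) b = (τ.comp q) b := by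
      refine hom_ext_of_generated hB.generated ?_
      rintro _ ⟨a, s, rfl⟩
      rw [NonUnitalStarAlgHom.comp_apply, hψgen, ← hμbar.map_mul, ← hτbar.map_mul, hμA', hμS]
    intro x y hxy
    obtain ⟨b, rfl⟩ := ClosedIdeal.Quotient.mk_surjective _ x
    obtain ⟨c, rfl⟩ := ClosedIdeal.Quotient.mk_surjective _ y
    rw [hΨ, hΨ] at hxy
    refine hτinj ?_
    have := (key b).symm.trans ((congrArg μ hxy).trans (key c))
    exact this
  have hΨsurj : Function.Surjective Ψ := by
    refine mem_of_generated hC.generated (T := NonUnitalStarAlgHom.range Ψ)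
      (NonUnitalStarAlgHom.isClosed_range_of_injective Ψ hΨinj) ?_
    rintro _ ⟨a, s, rfl⟩
    exact ⟨_, (hΨ _).trans (hψgen a s)⟩
  exact ⟨StarAlgEquiv.ofBijective Ψ ⟨hΨinj, hΨsurj⟩, fun a => (hΨ _).trans (hψA a),
    fun a s => (hΨ _).trans (hψgen a s)⟩

end Comparison

/-! ### The theorem, assembled from the preceding parts. -/

theorem mainTheorem3 {A : Type u} {S : Type v} [NonUnitalCStarAlgebra A] [PartialOrder A]
    [StarOrderedRing A] [AddCommMonoid S] (α : S → A →⋆ₙₐ[ℂ] A)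
    (hα : IsEndomorphismAction α)
    (hext : ∀ s, IsExtendible (α s))
    (hinj : ∀ s, Function.Injective (α s))
    (hher : ∀ s, HasHereditaryRange (α s)) :
    -- the defining formula makes sense: `ᾱ_s(1) a ᾱ_s(1)` lies in the range of `α_s`
    (∀ s a, (α s (hereditaryTransfer α hext s a) : 𝓜(ℂ, A)) =
      (hext s).extension 1 * (a : 𝓜(ℂ, A)) * (hext s).extension 1) ∧
    IsTransferAction α (hereditaryTransfer α hext) ∧
    -- both universal algebras exist
    (∃ (B : Type (max u v)) (_ : NonUnitalCStarAlgebra B) (iA : A →⋆ₙₐ[ℂ] B) (iS : S → 𝓜(ℂ, B)),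
      IsToeplitzCrossedProduct.{max u v} α (hereditaryTransfer α hext) iA iS) ∧
    (∃ (C : Type (max u v)) (_ : NonUnitalCStarAlgebra C) (jA : A →⋆ₙₐ[ℂ] C) (jS : S → 𝓜(ℂ, C)),
      IsSemigroupCrossedProduct.{max u v} α jA jS) ∧
    -- `A ⋊_{α,L} S ≅ A ⋊_α S`, canonically
    ∀ (B C : Type (max u v)) [NonUnitalCStarAlgebra B] [NonUnitalCStarAlgebra C]
      (iA : A →⋆ₙₐ[ℂ] B) (iS : S → 𝓜(ℂ, B)) (jA : A →⋆ₙₐ[ℂ] C) (jS : S → 𝓜(ℂ, C)),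
      IsToeplitzCrossedProduct.{max u v} α (hereditaryTransfer α hext) iA iS →
      IsSemigroupCrossedProduct.{max u v} α jA jS →
      ∃ Φ : TransferCrossedProduct α iA iS ≃⋆ₐ[ℂ] C,
        (∀ a, Φ (ClosedIdeal.Quotient.mk _ (iA a)) = jA a) ∧
        ∀ a s, Φ (ClosedIdeal.Quotient.mk _ (multRight (iA a) (iS s))) =
          multRight (jA a) (jS s) := by
  refine ⟨fun s a => ?_, isTransferAction_hereditaryTransfer hext hα hinj hher, ?_, ?_, ?_⟩
  · rw [apply_hereditaryTransfer hext hinj hher, coe_multRight, coe_multLeft]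
  · obtain ⟨B, hB, iA, iS, h⟩ :=
      exists_universalAlgebra (L := hereditaryTransfer α hext) False hext
    exact ⟨B, hB, iA, iS, h.congr fun H _ _ _ π V => isRelCovariant_false_iff hext hinj hher⟩
  · obtain ⟨C, hC, jA, jS, h⟩ :=
      exists_universalAlgebra (L := hereditaryTransfer α hext) True hext
    exact ⟨C, hC, jA, jS, h.congr fun H _ _ _ π V => isRelCovariant_true_iff hext hinj hher⟩
  · intro B C _ _ iA iS jA jS hB hC
    exact exists_starAlgEquiv_crossedProduct hext hinj hher hB hC
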